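/- **Setting.** $S$ is a finite set (discrete topology); $A,B$ are Borel spaces; for each $i\in S$, $A(i)\subset A$ and $B(i)\subset B$ are Borel sets; $\mathbb K=\{(i,a,b): i\in S,\ a\in A(i),\ b\in B(i)\}$. For $(i,a,b)\in\mathbb K$ let $p_{i,\cdot}(a,b)$ be a transition law on $S$, $F_{i,a,b}$ a distribution function on $[0,\infty)$ with $F_{i,a,b}(0)=0$, and $\rho^m_{(i,a,b)}:[0,\infty)\to\mathbb R$ the running cost of player $m=1,2$. Histories are elements of $H_n=(\mathbb K\times(0,\infty))^n\times S$. A policy $\pi^1\in\Pi_1$ of player 1 is a sequence of stochastic kernels $\pi^1_n$ on $A$ given $H_n$ with $\pi^1_n(A(i_n)\mid h_n)=1$; it is stationary, $\phi^1\in\Phi^1$, if $\pi^1_n(\cdot\mid h_n)=\phi^1(\cdot\mid i_n)$ for a stochastic kernel $\phi^1$ on $A$ given $S$ with $\phi^1(A(i)\mid i)=1$. $\Pi_2,\Phi^2$ are defined likewise with $B$. Let $\mathbb P_i^{\pi^1,\pi^2}$ be the law of $(X_n,A_n,B_n,S_n)_{n\ge0}$ such that $X_0=i$; given the history up to the $n$-th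 jump (which includes $X_n$), $A_n$ and $B_n$ are independent with laws $\pi^1_n,\pi^2_n$; then $S_n$ has distribution $F_{X_n,A_n,B_n}$; and then $X_{n+1}=j$ with probability $p_{X_n,j}(A_n,B_n)$. Put $T_n=\sum_{k<n}S_k$, $N_t=\sup\{n:T_n\le t\}$, $$\mathcal C^m_t=\sum_{k=0}^{N_t-1}\int_0^{S_k}\rho^m_{(X_k,A_k,B_k)}(r)\,dr+\int_0^{t-T_{N_t}}\rho^m_{(X_{N_t},A_{N_t},B_{N_t})}(r)\,dr,$$ and, for a fixed $\theta>0$, $J^m_\theta(i,\pi^1,\pi^2)=\limsup_{t\to\infty}\frac1{\theta t}\ln\mathbb E_i^{\pi^1,\pi^2}\big[e^{\theta\mathcal C^m_t}\big]$. **Assumptions.** 1. All $A(i),B(i)$ are compact; $(a,b)\mapsto p_{i,j}(a,b)$ is continuous on $A(i)\times B(i)$ for all $i,j$. There is a (fixed) constant $\beta>0$ with $F_{i,a,b}(\beta)=1$ on $\mathbb K$, such that for each $i$ and each bounded measurable $u$ the map $(a,b)\mapsto\int_0^\beta u\,dF_{i,a,b}$ is continuous on $A(i)\times B(i)$, and $(a,b,s)\mapsto\rho^m_{(i,a,b)}(s)$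 is continuous on $A(i)\times B(i)\times[0,\beta]$ for $m=1,2$. 2. Under every pair of stationary policies the embedded chain $(X_n)$ is irreducible. 3. $i^*\in S$ is a fixed state, $\tau^*=\inf\{n\ge1:X_n=i^*\}$, and there are constants $R,M$ with $\sup_{\phi^1\in\Phi^1,\,\phi^2\in\Phi^2,\,i\in S}\mathbb E_i^{\phi^1,\phi^2}[R^{\tau^*}]\le M$ and $e^{2\theta\beta M_\rho}\le R$, where $M_\rho=\max_{m=1,2}\sup_{\mathbb K\times[0,\beta]}|\rho^m_{(i,a,b)}(s)|$. **Theorem.** Under these assumptions, fix $(\phi^1,\phi^2)\in\Phi^1\times\Phi^2$. For $g\in\mathbb R$ and $(i,a,b)\in\mathbb K$ put $$\Gamma^g_m(i,a,b)=\int_0^\beta e^{\theta[\int_0^s\rho^m_{(i,a,b)}(t)dt-gs]}dF_{i,a,b}(s),\qquad D^g_m=\tfrac1\theta\ln\Gamma^g_m .$$ Then there exist constants $g^{\phi^1},g^{\phi^2}\in\mathbb R$ and functions $h^{\phi^1},h^{\phi^2}:S\to\mathbb R$ with $h^{\phi^1}(i^*)=h^{\phi^2}(i^*)=0$ such that: (i)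 for all $i\in S$, $$e^{\theta h^{\phi^2}(i)}=\inf_{\psi\in\mathcal P(A(i))}\int_{A(i)}\int_{B(i)}\Gamma_1^{g^{\phi^2}}(i,a,b)\sum_{j\in S}e^{\theta h^{\phi^2}(j)}p_{i,j}(a,b)\,\phi^2(db\mid i)\,\psi(da);$$ (ii) for all $i\in S$, $$e^{\theta h^{\phi^1}(i)}=\inf_{\varphi\in\mathcal P(B(i))}\int_{B(i)}\int_{A(i)}\Gamma_2^{g^{\phi^1}}(i,a,b)\sum_{j\in S}e^{\theta h^{\phi^1}(j)}p_{i,j}(a,b)\,\phi^1(da\mid i)\,\varphi(db);$$ (iii) for all $i\in S$, $g^{\phi^2}=\inf_{\pi^1\in\Pi_1}J^1_\theta(i,\pi^1,\phi^2)$ and $g^{\phi^1}=\inf_{\pi^2\in\Pi_2}J^2_\theta(i,\phi^1,\pi^2)$; (iv) for all $i\in S\setminus\{i^*\}$, $$h^{\phi^2}(i)=\inf_{\tilde\phi^1\in\Phi^1}\frac1\theta\ln\mathbb E_i^{\tilde\phi^1,\phi^2}\Big[e^{\theta\sum_{k=0}^{\tau^*-1}D_1^{g^{\phi^2}}(X_k,A_k,B_k)}\Big],\qquad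 h^{\phi^1}(i)=\inf_{\tilde\phi^2\in\Phi^2}\frac1\theta\ln\mathbb E_i^{\phi^1,\tilde\phi^2}\Big[e^{\theta\sum_{k=0}^{\tau^*-1}D_2^{g^{\phi^1}}(X_k,A_k,B_k)}\Big].$$ -/

import Mathlib

open MeasureTheory ProbabilityTheory Filter Topology Set
open scoped ENNReal

noncomputable section

/-- The set `𝕂` of admissible triples `(i, a, b)`: `a ∈ A(i)` and `b ∈ B(i)`. -/
def admissibleSet {S A B : Type*} (act₁ : S → Set A) (act₂ : S → Set B) : Set (S × A × B) :=
  {x | x.2.1 ∈ act₁ x.1 ∧ x.2.2 ∈ act₂ x.1}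

/-- The data of a two-player non-zero-sum semi-Markov game: finite state space `S`, action spaces
`A`, `B`, Borel sets of admissible actions, transition law `p_{i,j}(a,b)`, sojourn time law
`F_{i,a,b}`, and the running cost `ρ¹, ρ²` of each player.
The sojourn law is a probability measure on `(0, ∞)`, i.e. a distribution function on `[0, ∞)`
with `F(0) = 0`. Only the values of `ρ (i,a,b) s` for `0 ≤ s` are ever used. -/
structure SemiMarkovGame (S A B : Type*) [MeasurableSpace S] [MeasurableSpace A]
    [MeasurableSpace B] where
  act₁ : S → Set A
  act₂ : S → Set B
  measurableSet_act₁ : ∀ i, MeasurableSet (act₁ i)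
  measurableSet_act₂ : ∀ i, MeasurableSet (act₂ i)
  trans : Kernel (admissibleSet act₁ act₂) S
  isMarkov_trans : IsMarkovKernel trans
  sojourn : Kernel (admissibleSet act₁ act₂) (Ioi (0 : ℝ))
  isMarkov_sojourn : IsMarkovKernel sojourn
  ρ₁ : admissibleSet act₁ act₂ → ℝ → ℝ
  ρ₂ : admissibleSet act₁ act₂ → ℝ → ℝ

namespace SemiMarkovGame

attribute [instance] SemiMarkovGame.isMarkov_trans SemiMarkovGame.isMarkov_sojourn

section

variable {S A B : Type*} [Fintype S] [MeasurableSpace S] [DiscreteMeasurableSpace S]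
  [MeasurableSpace A] [MeasurableSpace B] (G : SemiMarkovGame S A B)

/-- The admissible state-action triples of the game. -/
abbrev K : Type _ := admissibleSet G.act₁ G.act₂

/-- What happens between two jumps: state, two actions and the sojourn time. -/
abbrev Stage : Type _ := G.K × Ioi (0 : ℝ)

/-- The admissible histories up to the `n`-th jump: `n` completed stages and the current state. -/
abbrev Hist (n : ℕ) : Type _ := (Fin n → G.Stage) × S

/-- The transition probability `p_{i,j}(a,b)` as a real number, for `k = (i,a,b)`. -/
def p (k : G.K) (j : S) : ℝ := (G.trans k).real {j}

/-- Randomized history-dependent policies choosing actions in a space `Act` subject to the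
constraint `adm`. -/
structure Policy {Act : Type*} [MeasurableSpace Act] (adm : S → Set Act) where
  kernel : ∀ n, Kernel (G.Hist n) Act
  isMarkov : ∀ n, IsMarkovKernel (kernel n)
  admissible : ∀ n h, kernel n h (adm h.2) = 1

attribute [instance] Policy.isMarkov

/-- `Π₁` -/
abbrev Policy₁ : Type _ := G.Policy G.act₁

/-- `Π₂` -/
abbrev Policy₂ : Type _ := G.Policy G.act₂

/-- Stochastic kernels on `Act` given `S` that respect the constraint `adm`: the stationary
policies. -/
structure StationaryPolicy {S Act : Type*} [MeasurableSpace S] [MeasurableSpace Act]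
    (adm : S → Set Act) where
  kernel : Kernel S Act
  isMarkov : IsMarkovKernel kernel
  admissible : ∀ i, kernel i (adm i) = 1

attribute [instance] StationaryPolicy.isMarkov

/-- `Φ¹` -/
abbrev Stat₁ : Type _ := StationaryPolicy G.act₁

/-- `Φ²` -/
abbrev Stat₂ : Type _ := StationaryPolicy G.act₂

/-- A stationary policy, seen as a policy: `π_n(· | h_n) = φ(· | i_n)`. -/
def StationaryPolicy.toPolicy {Act : Type*} [MeasurableSpace Act] {adm : S → Set Act}
    (φ : StationaryPolicy adm) : G.Policy adm where
  kernel _ := φ.kernel.comap Prod.snd measurable_snd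
  isMarkov _ := inferInstance
  admissible _ h := φ.admissible h.2

/-- The probability measures on `Act` that are carried by `C`, i.e. `𝒫(C)`. -/
abbrev ProbOn {Act : Type*} [MeasurableSpace Act] (C : Set Act) : Type _ :=
  {ψ : Measure Act // IsProbabilityMeasure ψ ∧ ψ C = 1}

theorem measurableSet_admissibleSet : MeasurableSet (admissibleSet G.act₁ G.act₂) := by
  have h : admissibleSet G.act₁ G.act₂ = ⋃ i : S, {i} ×ˢ (G.act₁ i ×ˢ G.act₂ i) := by
    ext ⟨i, a, b⟩
    simp [admissibleSet]
  rw [h]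
  exact MeasurableSet.iUnion fun i =>
    (measurableSet_singleton i).prod ((G.measurableSet_act₁ i).prod (G.measurableSet_act₂ i))

/-! ### The law of the game under a pair of policies -/

/-- The law on `𝕂` of `(X_n, A_n, B_n)` given the history: the state is the current one, and the
players choose their actions independently. -/
def actionKernel (π₁ : G.Policy₁) (π₂ : G.Policy₂) (n : ℕ) : Kernel (G.Hist n) G.K :=
  (Kernel.deterministic (Prod.snd : G.Hist n → S) measurable_snd ×ₖ
    (π₁.kernel n ×ₖ π₂.kernel n)).comapRight
      (MeasurableEmbedding.subtype_coe G.measurableSet_admissibleSet)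

instance (π₁ : G.Policy₁) (π₂ : G.Policy₂) (n : ℕ) :
    IsMarkovKernel (G.actionKernel π₁ π₂ n) := by
  refine Kernel.IsMarkovKernel.comapRight _ _ fun h => ?_
  have hsub : ({h.2} ×ˢ (G.act₁ h.2 ×ˢ G.act₂ h.2) : Set (S × A × B)) ⊆
      range (Subtype.val : G.K → S × A × B) := by
    rintro ⟨i, a, b⟩ ⟨hi, ha, hb⟩
    simp only [mem_singleton_iff] at hi
    subst hi
    exact ⟨⟨(h.2, a, b), ha, hb⟩, rfl⟩
  refine le_antisymm prob_le_one (le_trans (le_of_eq ?_) (measure_mono hsub))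
  rw [Kernel.prod_apply, Measure.prod_prod, Kernel.prod_apply, Measure.prod_prod,
    π₁.admissible, π₂.admissible, Kernel.deterministic_apply]
  simp

/-- The law of stage `n` (state, actions, sojourn time) given the history. -/
def stageKernel (π₁ : G.Policy₁) (π₂ : G.Policy₂) (n : ℕ) : Kernel (G.Hist n) G.Stage :=
  G.actionKernel π₁ π₂ n ⊗ₖ G.sojourn.prodMkLeft (G.Hist n)

instance (π₁ : G.Policy₁) (π₂ : G.Policy₂) (n : ℕ) :
    IsMarkovKernel (G.stageKernel π₁ π₂ n) := by
  unfold stageKernel; infer_instance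

/-- Reindexing of the stages `0, …, n` as a family over `Fin (n + 1)`. -/
def reindex (n : ℕ) (x : (j : Finset.Iic n) → G.Stage) : Fin (n + 1) → G.Stage :=
  fun j => x ⟨j, Finset.mem_Iic.2 (Nat.le_of_lt_succ j.2)⟩

/-- The law of the history up to the `(n+1)`-st jump given the stages `0, …, n`: the new state has
law `p_{X_n, ·}(A_n, B_n)`. -/
def historyKernel (n : ℕ) : Kernel ((j : Finset.Iic n) → G.Stage) (G.Hist (n + 1)) :=
  Kernel.deterministic (G.reindex n)
      (measurable_pi_lambda _ fun _ => measurable_pi_apply _) ×ₖ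
    G.trans.comap (fun x : (j : Finset.Iic n) → G.Stage => (x ⟨n, Finset.mem_Iic.2 le_rfl⟩).1)
      (measurable_fst.comp (measurable_pi_apply _))

instance (n : ℕ) : IsMarkovKernel (G.historyKernel n) := by
  unfold historyKernel; infer_instance

/-- The law of stage `n + 1` given the stages `0, …, n`. -/
def stepKernel (π₁ : G.Policy₁) (π₂ : G.Policy₂) (n : ℕ) :
    Kernel ((j : Finset.Iic n) → G.Stage) G.Stage :=
  G.stageKernel π₁ π₂ (n + 1) ∘ₖ G.historyKernel n

instance (π₁ : G.Policy₁) (π₂ : G.Policy₂) (n : ℕ) :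
    IsMarkovKernel (G.stepKernel π₁ π₂ n) := by
  unfold stepKernel; infer_instance

/-- `ℙ_i^{π¹,π²}`: the law of `(X_n, A_n, B_n, S_n)_n`, by the Ionescu-Tulcea theorem. -/
def law (π₁ : G.Policy₁) (π₂ : G.Policy₂) (i : S) : Measure (ℕ → G.Stage) :=
  Kernel.trajMeasure (X := fun _ => G.Stage)
    (G.stageKernel π₁ π₂ 0 ((fun j : Fin 0 => j.elim0), i)) (G.stepKernel π₁ π₂)

/-- `ℙ_i^{φ¹,φ²}` for a pair of stationary policies. -/
def statLaw (φ₁ : G.Stat₁) (φ₂ : G.Stat₂) (i : S) : Measure (ℕ → G.Stage) :=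
  G.law (StationaryPolicy.toPolicy G φ₁) (StationaryPolicy.toPolicy G φ₂) i

/-- The embedded chain `X_n`. -/
def state (n : ℕ) (ω : ℕ → G.Stage) : S := (ω n).1.1.1

/-- The jump time `T_n = S_0 + ⋯ + S_{n-1}`. -/
def jumpTime (n : ℕ) (ω : ℕ → G.Stage) : ℝ := ∑ k ∈ Finset.range n, ((ω k).2 : ℝ)

/-- The number of jumps `N_t = sup {n : T_n ≤ t}`. -/
def numJumps (t : ℝ) (ω : ℕ → G.Stage) : ℕ := sSup {n | G.jumpTime n ω ≤ t}

/-- The cost accumulated up to time `t` for the running cost `ρ`. -/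
def totalCost (ρ : G.K → ℝ → ℝ) (t : ℝ) (ω : ℕ → G.Stage) : ℝ :=
  (∑ k ∈ Finset.range (G.numJumps t ω), ∫ r in (0 : ℝ)..((ω k).2 : ℝ), ρ (ω k).1 r) +
    ∫ r in (0 : ℝ)..(t - G.jumpTime (G.numJumps t ω) ω), ρ (ω (G.numJumps t ω)).1 r

/-- The risk-sensitive average cost `limsup_{t → ∞} (1 / (θ t)) log 𝔼_i[exp (θ C_t)]`, with values
in `[-∞, ∞]`. -/
def avgCost (ρ : G.K → ℝ → ℝ) (θ : ℝ) (i : S) (π₁ : G.Policy₁) (π₂ : G.Policy₂) : EReal :=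
  limsup (fun t : ℝ => ((1 / (θ * t) : ℝ) : EReal) *
    ENNReal.log (∫⁻ ω, ENNReal.ofReal (Real.exp (θ * G.totalCost ρ t ω)) ∂(G.law π₁ π₂ i))) atTop

/-- The first return time `τ* = inf {n ≥ 1 : X_n = i*}`, equal to `⊤` if there is no return. -/
def returnTime (istar : S) (ω : ℕ → G.Stage) : WithTop ℕ :=
  hittingAfter G.state {istar} 1 ω

/-- The variable `R ^ τ*`, equal to `∞` if `τ* = ∞`. -/
def powReturnTime (istar : S) (R : ℝ) (ω : ℕ → G.Stage) : ℝ≥0∞ :=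
  if G.returnTime istar ω = ⊤ then ∞ else ENNReal.ofReal R ^ (G.returnTime istar ω).untopD 0

/-- The factor `∫ exp (θ (∫_0^s ρ_{(i,a,b)}(t) dt - g s)) dF_{i,a,b}(s)`. -/
def expFactor (ρ : G.K → ℝ → ℝ) (θ g : ℝ) (k : G.K) : ℝ :=
  ∫ s, Real.exp (θ * ((∫ t in (0 : ℝ)..(s : ℝ), ρ k t) - g * (s : ℝ))) ∂(G.sojourn k)

/-- The one-stage cost `D^g(i,a,b)`, the normalized logarithm of `expFactor`. -/
def stageCost (ρ : G.K → ℝ → ℝ) (θ g : ℝ) (k : G.K) : ℝ :=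
  (1 / θ) * Real.log (G.expFactor ρ θ g k)

/-- `(1/θ) log 𝔼_i^{φ¹,φ²}[exp (θ ∑_{k < τ*} D^g(X_k, A_k, B_k))]`. The value of the sum on
`τ* = ∞` is irrelevant when the embedded chain is irreducible. -/
def returnCost (ρ : G.K → ℝ → ℝ) (θ g : ℝ) (istar i : S) (φ₁ : G.Stat₁) (φ₂ : G.Stat₂) : EReal :=
  ((1 / θ : ℝ) : EReal) * ENNReal.log (∫⁻ ω, ENNReal.ofReal (Real.exp (θ *
    ∑ k ∈ Finset.range ((G.returnTime istar ω).untopD 0), G.stageCost ρ θ g (ω k).1))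
      ∂(G.statLaw φ₁ φ₂ i))

/-- The law `δ_i ⊗ ψ ⊗ φ` on `𝕂`: the state is `i` and the actions have laws `ψ` and `φ`. -/
def actionLaw (i : S) (ψ : Measure A) (φ : Measure B) : Measure G.K :=
  ((Measure.dirac i).prod (ψ.prod φ)).comap Subtype.val

/-- The integral of `∫ exp (θ (∫_0^s ρ_{(i,a,b)}(t) dt - g s)) dF_{i,a,b}(s) *
∑_j exp (θ h(j)) p_{i,j}(a,b)` over `a ∈ A(i)` and `b ∈ B(i)` with respect to `ψ(da) φ(db)`. -/
def bellman (ρ : G.K → ℝ → ℝ) (θ g : ℝ) (h : S → ℝ) (i : S) (ψ : Measure A) (φ : Measure B) :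
    ℝ≥0∞ :=
  ∫⁻ k, ENNReal.ofReal (G.expFactor ρ θ g k * ∑ j, Real.exp (θ * h j) * G.p k j)
    ∂(G.actionLaw i ψ φ)

/-- `sup |ρ_{(i,a,b)}(s)|` over `(i,a,b) ∈ 𝕂` and `0 ≤ s ≤ β`. -/
def costBound (ρ : G.K → ℝ → ℝ) (β : ℝ) : ℝ := ⨆ x : G.K × Icc (0 : ℝ) β, |ρ x.1 x.2|

/-- Compactness and continuity, with sojourn times bounded by `β`. The state space carries the
discrete topology, so continuity on `𝕂` is continuity in `(a,b) ∈ A(i) × B(i)` for each `i`. -/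
structure Regular [TopologicalSpace S] [TopologicalSpace A] [TopologicalSpace B] (β : ℝ) :
    Prop where
  isCompact_act₁ : ∀ i, IsCompact (G.act₁ i)
  isCompact_act₂ : ∀ i, IsCompact (G.act₂ i)
  continuous_p : ∀ j, Continuous fun k => G.p k j
  pos : 0 < β
  sojourn_le : ∀ k, G.sojourn k {s | (s : ℝ) ≤ β} = 1
  continuous_sojourn : ∀ u : Ioi (0 : ℝ) → ℝ, Measurable u → (∃ M, ∀ s, |u s| ≤ M) →
    Continuous fun k => ∫ s, u s ∂(G.sojourn k)
  continuousOn_ρ₁ : ContinuousOn (fun x : G.K × ℝ => G.ρ₁ x.1 x.2) (univ ×ˢ Icc 0 β)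
  continuousOn_ρ₂ : ContinuousOn (fun x : G.K × ℝ => G.ρ₂ x.1 x.2) (univ ×ˢ Icc 0 β)

/-- Under each pair of stationary policies the embedded chain `(X_n)` is irreducible. -/
def Irreducible : Prop :=
  ∀ (φ₁ : G.Stat₁) (φ₂ : G.Stat₂) (i j : S), ∃ n, 0 < G.statLaw φ₁ φ₂ i {ω | G.state n ω = j}

/-- `sup_{φ¹, φ², i} 𝔼_i^{φ¹,φ²}[R ^ τ*] ≤ M` and `exp (2 θ β M_ρ) ≤ R`. -/
structure ReturnBound (θ β : ℝ) (istar : S) (R M : ℝ) : Prop where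
  moment_le : (⨆ (φ₁ : G.Stat₁) (φ₂ : G.Stat₂) (i : S),
    ∫⁻ ω, G.powReturnTime istar R ω ∂(G.statLaw φ₁ φ₂ i)) ≤ ENNReal.ofReal M
  exp_le : Real.exp (2 * θ * β * max (G.costBound G.ρ₁ β) (G.costBound G.ρ₂ β)) ≤ R

end

end SemiMarkovGame

end

noncomputable section

set_option linter.unusedSectionVars false

/-! Once the opponent's stationary policy is fixed, each player faces a one-player risk-sensitive
control problem: in state $i$ choose a law on $\mathbb K$ from a set $D(i)$. Both best responses are
instances of `IsActionFamily.exists_solution`; the two players differ only in which marginal of the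
action law is free.

Fix $g$ and take $\Gamma^g$ as the multiplicative cost of a stage. Let $V_g(i)$ be the minimal
expected product of these factors until the return to $i^*$, built as the increasing limit of value
iteration from $0$. For $|g|\le c=M_\rho$ each factor is at most $e^{2\theta\beta M_\rho}\le R$, so
$R^{\tau^*}$ dominates every such product. This makes $V_g$ finite, and by compactness it is
attained by a stationary selection. It solves the dynamic programming equation in which the value at
$i^*$ is replaced by $1$.

The remaining task is to choose $g$ with $V_g(i^*)=1$, for then the replacement changes nothing and
$V_g=e^{\theta h}$ solves the full optimality equation. At $g=c$ all factors are at most $1$, at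
$g=-c$ at least $1$. The infimum of the $g\in[-c,c]$ with $V_g(i^*)\le1$ works
(`exists_value_eq_one`): value iterates depend continuously on $g$, so the inequality passes to the
infimum; were it strict there, dominated convergence under one optimal policy would give a smaller
admissible $g$.

Two verification arguments interpret the solution $(g,u)$, $u=e^{\theta h}$. Stopping the product of
stage weights times $u(X_n)$ at $\tau^*$ gives the representation of $h$ (`le_lintegral_returnProd`,
`lintegral_returnProd_le`). Stopping it at the first jump after $t$ gives $\mathbb
E[e^{\theta\mathcal C_t}]$ compared with $e^{\theta gt}$ up to constants independent of $t$, because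
the overshoot lasts at most $\beta$; hence $g$ is the optimal average cost, also among
history-dependent policies (`le_avgCost`, `avgCost_le`). -/

/-! ### Disintegration of the trajectory law, one stage at a time -/

theorem map_eval_zero_trajMeasure {E : Type*} [MeasurableSpace E]
    (μ₀ : Measure E) [IsProbabilityMeasure μ₀]
    (κ : (n : ℕ) → Kernel ((i : Finset.Iic n) → E) E) [∀ n, IsMarkovKernel (κ n)] :
    (Kernel.trajMeasure (X := fun _ => E) μ₀ κ).map (fun x => x 0) = μ₀ := by
  have h : (Kernel.trajMeasure (X := fun _ => E) μ₀ κ).map (Preorder.frestrictLe 0) =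
      μ₀.map (MeasurableEquiv.piUnique (fun _ : Finset.Iic 0 => E)).symm := by
    rw [Kernel.trajMeasure, Measure.map_comp _ _ (by fun_prop), Kernel.traj_map_frestrictLe,
      Kernel.partialTraj_self, Measure.id_comp]
  have he : Measurable fun y : (i : Finset.Iic 0) → E => y ⟨0, Finset.mem_Iic.2 le_rfl⟩ :=
    measurable_pi_apply _
  have h2 := congrArg (Measure.map fun y : (i : Finset.Iic 0) → E =>
    y ⟨0, Finset.mem_Iic.2 le_rfl⟩) h
  rw [Measure.map_map he (Preorder.measurable_frestrictLe 0),
    Measure.map_map he (MeasurableEquiv.measurable _)] at h2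
  refine Eq.trans ?_ (h2.trans ?_)
  · rfl
  · exact Measure.map_id

namespace SemiMarkovGame

variable {S A B : Type*} [Fintype S] [MeasurableSpace S] [DiscreteMeasurableSpace S]
  [MeasurableSpace A] [MeasurableSpace B] (G : SemiMarkovGame S A B)

instance (π₁ : G.Policy₁) (π₂ : G.Policy₂) (i : S) : IsProbabilityMeasure (G.law π₁ π₂ i) := by
  unfold law; infer_instance

theorem ae_actionKernel_state_eq (π₁ : G.Policy₁) (π₂ : G.Policy₂) (n : ℕ) (h : G.Hist n) :
    ∀ᵐ k ∂G.actionKernel π₁ π₂ n h, k.1.1 = h.2 := by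
  have hm : MeasurableSet {k : G.K | ¬ k.1.1 = h.2} :=
    ((measurableSet_singleton h.2).preimage (measurable_fst.comp measurable_subtype_coe)).compl
  rw [ae_iff, actionKernel, Kernel.comapRight_apply' _ _ _ hm]
  refine measure_mono_null (t := {h.2}ᶜ ×ˢ univ) ?_ ?_
  · rintro _ ⟨k, hk, rfl⟩
    exact ⟨hk, mem_univ _⟩
  · rw [Kernel.prod_apply, Measure.prod_prod, Kernel.deterministic_apply]
    simp

theorem lintegral_stageKernel (π₁ : G.Policy₁) (π₂ : G.Policy₂) (n : ℕ) (h : G.Hist n)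
    {f : G.Stage → ℝ≥0∞} (hf : Measurable f) :
    ∫⁻ x, f x ∂G.stageKernel π₁ π₂ n h =
      ∫⁻ k, ∫⁻ s, f (k, s) ∂G.sojourn k ∂G.actionKernel π₁ π₂ n h := by
  rw [stageKernel, Kernel.lintegral_compProd _ _ _ hf]
  rfl

/-- A stage stores the current state a second time. This almost sure identity lets the state in a
history be read off the trajectory. -/
theorem ae_stageKernel_state_eq (π₁ : G.Policy₁) (π₂ : G.Policy₂) (n : ℕ) (h : G.Hist n) :
    ∀ᵐ x ∂G.stageKernel π₁ π₂ n h, x.1.1.1 = h.2 := by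
  have hm : MeasurableSet {x : G.Stage | ¬ x.1.1.1 = h.2} :=
    ((measurableSet_singleton h.2).preimage
      (measurable_fst.comp (measurable_subtype_coe.comp measurable_fst))).compl
  rw [ae_iff, ← lintegral_indicator_one hm,
    lintegral_stageKernel _ _ _ _ _ (measurable_one.indicator hm)]
  refine lintegral_eq_zero_of_ae_eq_zero ?_
  filter_upwards [G.ae_actionKernel_state_eq π₁ π₂ n h] with k hk
  simp [indicator, hk]

theorem measurable_state (n : ℕ) : Measurable (G.state n) :=
  measurable_fst.comp (measurable_subtype_coe.comp (measurable_fst.comp (measurable_pi_apply n)))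

/-- The history up to the `n`-th jump along a trajectory. -/
def hist (n : ℕ) (ω : ℕ → G.Stage) : G.Hist n := (fun j => ω j, G.state n ω)

theorem measurable_reindex (n : ℕ) : Measurable (G.reindex n) :=
  measurable_pi_lambda _ fun _ => measurable_pi_apply _

variable (π₁ : G.Policy₁) (π₂ : G.Policy₂) (i : S)

theorem lintegral_law_eval_zero {f : G.Stage → ℝ≥0∞} (hf : Measurable f) :
    ∫⁻ ω, f (ω 0) ∂G.law π₁ π₂ i =
      ∫⁻ x, f x ∂G.stageKernel π₁ π₂ 0 ((fun j : Fin 0 => j.elim0), i) := by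
  conv_rhs => rw [← map_eval_zero_trajMeasure
    (G.stageKernel π₁ π₂ 0 ((fun j : Fin 0 => j.elim0), i)) (G.stepKernel π₁ π₂)]
  rw [lintegral_map hf (measurable_pi_apply 0)]
  rfl

/-- This is the Ionescu-Tulcea disintegration with `stepKernel` unfolded: the next state is drawn
first, then the stage given the enlarged history. -/
theorem lintegral_law_step (n : ℕ) {f : ((j : Finset.Iic n) → G.Stage) × G.Stage → ℝ≥0∞}
    (hf : Measurable f) :
    ∫⁻ ω, f (Preorder.frestrictLe n ω, ω (n + 1)) ∂G.law π₁ π₂ i =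
      ∫⁻ ω, ∫⁻ j, ∫⁻ x, f (Preorder.frestrictLe n ω, x)
        ∂G.stageKernel π₁ π₂ (n + 1) ((fun j : Fin (n + 1) => ω j), j) ∂G.trans (ω n).1
          ∂G.law π₁ π₂ i := by
  have hmap := Kernel.map_frestrictLe_trajMeasure_compProd_eq_map_trajMeasure
    (X := fun _ => G.Stage) (κ := G.stepKernel π₁ π₂)
    (μ₀ := G.stageKernel π₁ π₂ 0 ((fun j : Fin 0 => j.elim0), i)) (a := n)
  have hr : Measurable (Preorder.frestrictLe (π := fun _ : ℕ => G.Stage) n) :=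
    Preorder.measurable_frestrictLe n
  have h1 : ∫⁻ ω, f (Preorder.frestrictLe n ω, ω (n + 1)) ∂G.law π₁ π₂ i =
      ∫⁻ z, f z ∂((G.law π₁ π₂ i).map (fun x => (Preorder.frestrictLe n x, x (n + 1)))) :=
    (lintegral_map hf (hr.prodMk (measurable_pi_apply _))).symm
  rw [h1]
  unfold law at hmap ⊢
  rw [← hmap, Measure.lintegral_compProd hf, lintegral_map _ hr]
  · refine lintegral_congr fun ω => ?_
    have hf' : Measurable fun x => f (Preorder.frestrictLe n ω, x) :=
      hf.comp measurable_prodMk_left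
    rw [stepKernel, Kernel.lintegral_comp _ _ _ hf', historyKernel,
      Kernel.lintegral_prod _ _ _
        (Measurable.lintegral_kernel (κ := G.stageKernel π₁ π₂ (n + 1)) hf'),
      Kernel.lintegral_deterministic']
    · rfl
    · exact Measurable.lintegral_prod_right'
        (Measurable.lintegral_kernel (κ := G.stageKernel π₁ π₂ (n + 1)) hf')
  · exact Measurable.lintegral_kernel_prod_right' hf

/-- The history up to the `0`-th jump is the initial state. -/
theorem lintegral_law_hist_zero {f : G.Hist 0 → ℝ≥0∞} (hf : Measurable f) :
    ∫⁻ ω, f (G.hist 0 ω) ∂G.law π₁ π₂ i = f ((fun j : Fin 0 => j.elim0), i) := by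
  have h : ∀ ω : ℕ → G.Stage, G.hist 0 ω = ((fun j : Fin 0 => j.elim0), (ω 0).1.1.1) :=
    fun ω => Prod.ext (funext fun j => j.elim0) rfl
  simp_rw [h]
  rw [G.lintegral_law_eval_zero π₁ π₂ i (f := fun x => f ((fun j : Fin 0 => j.elim0), x.1.1.1))]
  · rw [lintegral_congr_ae (g := fun _ => f ((fun j : Fin 0 => j.elim0), i))]
    · simp
    · filter_upwards [G.ae_stageKernel_state_eq π₁ π₂ 0 ((fun j : Fin 0 => j.elim0), i)] with x hx
      rw [hx]
  · exact hf.comp (measurable_const.prodMk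
      (measurable_fst.comp (measurable_subtype_coe.comp measurable_fst)))

theorem lintegral_law_hist_succ (n : ℕ) {f : G.Hist (n + 1) → ℝ≥0∞} (hf : Measurable f) :
    ∫⁻ ω, f (G.hist (n + 1) ω) ∂G.law π₁ π₂ i =
      ∫⁻ ω, ∫⁻ j, f ((fun j => ω j), j) ∂G.trans (ω n).1 ∂G.law π₁ π₂ i := by
  have h := G.lintegral_law_step π₁ π₂ i n (f := fun z => f (G.reindex n z.1, z.2.1.1.1))
    (hf.comp (((G.measurable_reindex n).comp measurable_fst).prodMk
      (measurable_fst.comp (measurable_subtype_coe.comp (measurable_fst.comp measurable_snd)))))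
  refine h.trans (lintegral_congr fun ω => lintegral_congr fun j => ?_)
  rw [lintegral_congr_ae (g := fun _ => f ((fun j => ω j), j))]
  · simp
  · filter_upwards [G.ae_stageKernel_state_eq π₁ π₂ (n + 1) ((fun j => ω j), j)] with x hx
    rw [hx]
    rfl

theorem lintegral_law_hist_stage (n : ℕ) {f : G.Hist n × G.Stage → ℝ≥0∞} (hf : Measurable f) :
    ∫⁻ ω, f (G.hist n ω, ω n) ∂G.law π₁ π₂ i =
      ∫⁻ ω, ∫⁻ x, f (G.hist n ω, x) ∂G.stageKernel π₁ π₂ n (G.hist n ω) ∂G.law π₁ π₂ i := by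
  cases n with
  | zero =>
    have h : ∀ ω : ℕ → G.Stage, G.hist 0 ω = ((fun j : Fin 0 => j.elim0), (ω 0).1.1.1) :=
      fun ω => Prod.ext (funext fun j => j.elim0) rfl
    rw [G.lintegral_law_hist_zero π₁ π₂ i (f := fun h => ∫⁻ x, f (h, x) ∂G.stageKernel π₁ π₂ 0 h)
      (Measurable.lintegral_kernel_prod_right' hf)]
    simp_rw [h]
    rw [G.lintegral_law_eval_zero π₁ π₂ i
      (f := fun x => f (((fun j : Fin 0 => j.elim0), x.1.1.1), x))]
    · refine lintegral_congr_ae ?_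
      filter_upwards [G.ae_stageKernel_state_eq π₁ π₂ 0 ((fun j : Fin 0 => j.elim0), i)] with x hx
      rw [hx]
    · exact hf.comp ((measurable_const.prodMk
        (measurable_fst.comp (measurable_subtype_coe.comp measurable_fst))).prodMk measurable_id)
  | succ n =>
    rw [G.lintegral_law_hist_succ π₁ π₂ i n
      (f := fun h => ∫⁻ x, f (h, x) ∂G.stageKernel π₁ π₂ (n + 1) h)
      (Measurable.lintegral_kernel_prod_right' hf)]
    have h := G.lintegral_law_step π₁ π₂ i n
      (f := fun z => f ((G.reindex n z.1, z.2.1.1.1), z.2))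
      (hf.comp ((((G.measurable_reindex n).comp measurable_fst).prodMk
        (measurable_fst.comp (measurable_subtype_coe.comp
          (measurable_fst.comp measurable_snd)))).prodMk measurable_snd))
    refine h.trans (lintegral_congr fun ω => lintegral_congr fun j => lintegral_congr_ae ?_)
    filter_upwards [G.ae_stageKernel_state_eq π₁ π₂ (n + 1) ((fun j => ω j), j)] with x hx
    rw [hx]
    rfl

/-- One step of the controlled process: the expectation of a functional of the next stage and the
next state given the history. -/
theorem lintegral_law_one_step (n : ℕ) {F : G.Hist n → ℝ≥0∞} (hF : Measurable F)
    {w : G.Stage → ℝ≥0∞} (hw : Measurable w) (u : S → ℝ≥0∞) :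
    ∫⁻ ω, F (G.hist n ω) * w (ω n) * u (G.state (n + 1) ω) ∂G.law π₁ π₂ i =
      ∫⁻ ω, F (G.hist n ω) * ∫⁻ k, (∫⁻ s, w (k, s) ∂G.sojourn k) * ∑ j, G.trans k {j} * u j
        ∂G.actionKernel π₁ π₂ n (G.hist n ω) ∂G.law π₁ π₂ i := by
  have hu : Measurable u := measurable_of_finite u
  have hsum : ∀ k, ∫⁻ j, u j ∂G.trans k = ∑ j, G.trans k {j} * u j := fun k => by
    rw [lintegral_fintype]
    exact Finset.sum_congr rfl fun j _ => mul_comm _ _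
  have hmeas : Measurable fun x : G.Stage => w x * ∑ j, G.trans x.1 {j} * u j := by
    refine hw.mul (Finset.measurable_sum _ fun j _ => Measurable.mul_const ?_ _)
    exact (G.trans.measurable_coe (measurableSet_singleton j)).comp measurable_fst
  have hst : Measurable fun x : G.Stage => x.1.1.1 :=
    measurable_fst.comp (measurable_subtype_coe.comp measurable_fst)
  -- The history at jump $n$ is recovered from that at jump $n+1$ by dropping the last stage and
  -- taking its state component as the current state.
  have hF' : Measurable fun h : G.Hist (n + 1) =>
      F (fun j => h.1 j.castSucc, (h.1 (Fin.last n)).1.1.1) * w (h.1 (Fin.last n)) := by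
    refine (hF.comp ((measurable_pi_lambda _ fun j => ?_).prodMk (hst.comp ?_))).mul (hw.comp ?_) <;>
    exact (measurable_pi_apply _).comp measurable_fst
  refine (G.lintegral_law_hist_succ π₁ π₂ i n (f := fun h =>
    F (fun j => h.1 j.castSucc, (h.1 (Fin.last n)).1.1.1) * w (h.1 (Fin.last n)) * u h.2)
    (hF'.mul (hu.comp measurable_snd))).trans ?_
  have h2 : ∀ ω : ℕ → G.Stage, ∫⁻ j, F (G.hist n ω) * w (ω n) * u j ∂G.trans (ω n).1 =
      F (G.hist n ω) * (w (ω n) * ∑ j, G.trans (ω n).1 {j} * u j) := fun ω => by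
    rw [lintegral_const_mul _ hu, hsum, mul_assoc]
  refine (lintegral_congr h2).trans ?_
  refine (G.lintegral_law_hist_stage π₁ π₂ i n
    (f := fun z => F z.1 * (w z.2 * ∑ j, G.trans z.2.1 {j} * u j))
    ((hF.comp measurable_fst).mul (hmeas.comp measurable_snd))).trans ?_
  refine lintegral_congr fun ω => ?_
  simp only
  rw [lintegral_const_mul _ hmeas, G.lintegral_stageKernel _ _ _ _ hmeas]
  congr 1
  refine lintegral_congr fun k => ?_
  simp only
  have hwk : Measurable fun s => w (k, s) := hw.comp measurable_prodMk_left
  rw [lintegral_mul_const _ hwk]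

end SemiMarkovGame

/-! ### Telescoping in place of optional stopping -/

/-- Optional stopping without subtraction: `b n` plays the role of the mass stopped at step `n` and
`a n` of the mass still running. The running mass has to vanish in this direction. -/
theorem ENNReal.le_tsum_of_le_add_of_tendsto_zero {a b : ℕ → ℝ≥0∞}
    (h : ∀ n, a n ≤ b n + a (n + 1)) (ha : Tendsto a atTop (𝓝 0)) : a 0 ≤ ∑' n, b n := by
  have h1 : ∀ n, a 0 ≤ ∑' n, b n + a n := by
    intro n
    have : a 0 ≤ ∑ k ∈ Finset.range n, b k + a n := by
      induction n with
      | zero => simp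
      | succ n ih =>
        rw [Finset.sum_range_succ, add_assoc]
        exact ih.trans (add_le_add le_rfl (h n))
    exact this.trans (add_le_add (ENNReal.sum_le_tsum _) le_rfl)
  have h2 : Tendsto (fun n => ∑' n, b n + a n) atTop (𝓝 (∑' n, b n + 0)) :=
    tendsto_const_nhds.add ha
  rw [add_zero] at h2
  exact ge_of_tendsto' h2 h1

/-- In this direction the running mass is simply discarded, so no decay is required. -/
theorem ENNReal.tsum_le_of_add_le {a b : ℕ → ℝ≥0∞} (h : ∀ n, b n + a (n + 1) ≤ a n) :
    ∑' n, b n ≤ a 0 := by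
  refine ENNReal.tsum_le_of_sum_range_le fun n => ?_
  have : ∑ k ∈ Finset.range n, b k + a n ≤ a 0 := by
    induction n with
    | zero => simp
    | succ n ih =>
      rw [Finset.sum_range_succ, add_assoc]
      exact (add_le_add le_rfl (h n)).trans ih
  exact le_self_add.trans this

/-! ### The one-stage operator and its iteration along trajectories -/

namespace SemiMarkovGame

variable {S A B : Type*} [Fintype S] [MeasurableSpace S] [DiscreteMeasurableSpace S]
  [MeasurableSpace A] [MeasurableSpace B] (G : SemiMarkovGame S A B)

/-- The integral of `γ(k) ∑_j p(k,j) u(j)` over the law `μ` of the current state and actions. -/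
def stageOp (γ : G.K → ℝ≥0∞) (u : S → ℝ≥0∞) (μ : Measure G.K) : ℝ≥0∞ :=
  ∫⁻ k, γ k * ∑ j, G.trans k {j} * u j ∂μ

theorem measurable_trans_singleton (j : S) : Measurable fun k => G.trans k {j} :=
  G.trans.measurable_coe (measurableSet_singleton j)

theorem measurable_sum_trans (u : S → ℝ≥0∞) : Measurable fun k => ∑ j, G.trans k {j} * u j :=
  Finset.measurable_sum _ fun j _ => (G.measurable_trans_singleton j).mul_const _

theorem measurable_mul_sum_trans {γ : G.K → ℝ≥0∞} (hγ : Measurable γ) (u : S → ℝ≥0∞) :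
    Measurable fun k => γ k * ∑ j, G.trans k {j} * u j :=
  hγ.mul (G.measurable_sum_trans u)

theorem sum_trans (k : G.K) : ∑ j, G.trans k {j} = 1 := by
  rw [← measure_univ (μ := G.trans k), ← Finset.coe_univ, ← sum_measure_singleton]

theorem stageOp_mono {γ γ' : G.K → ℝ≥0∞} (hγ : ∀ k, γ k ≤ γ' k) {u v : S → ℝ≥0∞}
    (h : ∀ j, u j ≤ v j) (μ : Measure G.K) : G.stageOp γ u μ ≤ G.stageOp γ' v μ :=
  lintegral_mono fun k => mul_le_mul' (hγ k)
    (Finset.sum_le_sum fun j _ => mul_le_mul' le_rfl (h j))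

theorem stageOp_const_mul (γ : G.K → ℝ≥0∞) (hγ : Measurable γ) (u : S → ℝ≥0∞) (c : ℝ≥0∞)
    (μ : Measure G.K) : G.stageOp (fun k => c * γ k) u μ = c * G.stageOp γ u μ := by
  unfold stageOp
  rw [← lintegral_const_mul _ (G.measurable_mul_sum_trans hγ u)]
  exact lintegral_congr fun k => by rw [mul_assoc]

theorem stageOp_mul_const (γ : G.K → ℝ≥0∞) (hγ : Measurable γ) (u : S → ℝ≥0∞) (c : ℝ≥0∞)
    (μ : Measure G.K) : G.stageOp γ (fun j => c * u j) μ = c * G.stageOp γ u μ := by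
  unfold stageOp
  rw [← lintegral_const_mul _ (G.measurable_mul_sum_trans hγ u)]
  refine lintegral_congr fun k => ?_
  rw [mul_left_comm c]
  congr 1
  rw [Finset.mul_sum]
  exact Finset.sum_congr rfl fun j _ => by rw [mul_left_comm]

theorem stageOp_const_le {γ : G.K → ℝ≥0∞} {c : ℝ≥0∞} (hγ : ∀ k, γ k ≤ c) (a : ℝ≥0∞)
    (μ : Measure G.K) [IsProbabilityMeasure μ] : G.stageOp γ (fun _ => a) μ ≤ c * a := by
  have h : ∀ k, γ k * ∑ j, G.trans k {j} * a ≤ c * a := fun k => by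
    rw [← Finset.sum_mul, sum_trans, one_mul]
    exact mul_le_mul' (hγ k) le_rfl
  exact (lintegral_mono h).trans (by simp)

/-- A uniform error in `u` is amplified at most by the bound on `γ`; this controls the passage to
the limit in value iteration. -/
theorem stageOp_add_const_le {γ : G.K → ℝ≥0∞} (hγm : Measurable γ) {c : ℝ≥0∞}
    (hγ : ∀ k, γ k ≤ c) (u : S → ℝ≥0∞) (a : ℝ≥0∞) (μ : Measure G.K) [IsProbabilityMeasure μ] :
    G.stageOp γ (fun j => u j + a) μ ≤ G.stageOp γ u μ + c * a := by
  refine le_trans (le_of_eq ?_) (add_le_add le_rfl (G.stageOp_const_le hγ a μ))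
  unfold stageOp
  rw [← lintegral_add_left (G.measurable_mul_sum_trans hγm u)]
  refine lintegral_congr fun k => ?_
  rw [← mul_add, ← Finset.sum_add_distrib]
  simp_rw [mul_add]

variable (π₁ : G.Policy₁) (π₂ : G.Policy₂) (i : S)

/-- Given the current state and actions, the sojourn time and the next state are independent, so the
weight `w` may be replaced by its mean `γ`. The set `E` is decided by the history at jump `n`; it
will say that the process has not been stopped yet. -/
theorem lintegral_law_stageOp (n : ℕ) {E : Set (G.Hist n)} (hE : MeasurableSet E)
    {w : G.Stage → ℝ≥0∞} (hw : Measurable w) {γ : G.K → ℝ≥0∞}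
    (hγ : ∀ k, ∫⁻ s, w (k, s) ∂G.sojourn k = γ k) (v : S → ℝ≥0∞) :
    ∫⁻ ω, (∏ k ∈ Finset.range (n + 1), w (ω k)) * E.indicator 1 (G.hist n ω) *
        v (G.state (n + 1) ω) ∂G.law π₁ π₂ i =
      ∫⁻ ω, (∏ k ∈ Finset.range n, w (ω k)) * E.indicator 1 (G.hist n ω) *
        G.stageOp γ v (G.actionKernel π₁ π₂ n (G.hist n ω)) ∂G.law π₁ π₂ i := by
  have hF : Measurable fun h : G.Hist n =>
      (∏ k : Fin n, w (h.1 k)) * E.indicator (1 : G.Hist n → ℝ≥0∞) h := by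
    refine (Finset.measurable_prod _ fun k _ => hw.comp ?_).mul (measurable_one.indicator hE)
    exact (measurable_pi_apply k).comp measurable_fst
  have hP : ∀ ω : ℕ → G.Stage, ∏ k ∈ Finset.range n, w (ω k) =
      ∏ k : Fin n, w ((G.hist n ω).1 k) := fun ω => Finset.prod_range fun k => w (ω k)
  have h := G.lintegral_law_one_step π₁ π₂ i n hF hw v
  simp_rw [← hP, hγ] at h
  refine Eq.trans (lintegral_congr fun ω => ?_) h
  rw [Finset.prod_range_succ]
  ring

/-- If `u` is dominated by the stage operator applied to `v` as long as the history is in `E`, then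
so is its expectation by the one of `v` one step later. -/
theorem lintegral_law_le_succ (n : ℕ) {E : Set (G.Hist n)} (hE : MeasurableSet E)
    {w : G.Stage → ℝ≥0∞} (hw : Measurable w) {γ : G.K → ℝ≥0∞}
    (hγ : ∀ k, ∫⁻ s, w (k, s) ∂G.sojourn k = γ k) {u v : S → ℝ≥0∞}
    (huv : ∀ h : G.Hist n, u h.2 ≤ G.stageOp γ v (G.actionKernel π₁ π₂ n h)) :
    ∫⁻ ω, (∏ k ∈ Finset.range n, w (ω k)) * E.indicator 1 (G.hist n ω) *
        u (G.state n ω) ∂G.law π₁ π₂ i ≤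
      ∫⁻ ω, (∏ k ∈ Finset.range (n + 1), w (ω k)) * E.indicator 1 (G.hist n ω) *
        v (G.state (n + 1) ω) ∂G.law π₁ π₂ i := by
  rw [G.lintegral_law_stageOp π₁ π₂ i n hE hw hγ v]
  exact lintegral_mono fun ω => mul_le_mul' le_rfl (huv (G.hist n ω))

theorem lintegral_law_succ_le (n : ℕ) {E : Set (G.Hist n)} (hE : MeasurableSet E)
    {w : G.Stage → ℝ≥0∞} (hw : Measurable w) {γ : G.K → ℝ≥0∞}
    (hγ : ∀ k, ∫⁻ s, w (k, s) ∂G.sojourn k = γ k) {u v : S → ℝ≥0∞}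
    (huv : ∀ h : G.Hist n, G.stageOp γ v (G.actionKernel π₁ π₂ n h) ≤ u h.2) :
    ∫⁻ ω, (∏ k ∈ Finset.range (n + 1), w (ω k)) * E.indicator 1 (G.hist n ω) *
        v (G.state (n + 1) ω) ∂G.law π₁ π₂ i ≤
      ∫⁻ ω, (∏ k ∈ Finset.range n, w (ω k)) * E.indicator 1 (G.hist n ω) *
        u (G.state n ω) ∂G.law π₁ π₂ i := by
  rw [G.lintegral_law_stageOp π₁ π₂ i n hE hw hγ v]
  exact lintegral_mono fun ω => mul_le_mul' le_rfl (huv (G.hist n ω))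

theorem lintegral_law_state_zero (u : S → ℝ≥0∞) :
    ∫⁻ ω, u (G.state 0 ω) ∂G.law π₁ π₂ i = u i :=
  G.lintegral_law_hist_zero π₁ π₂ i (f := fun h => u h.2)
    ((measurable_of_finite u).comp measurable_snd)

/-! ### The first return -/

variable (istar : S)

/-- The trajectories that do not visit `istar` at the times `1, …, n`. -/
def avoids (n : ℕ) : Set (ℕ → G.Stage) := {ω | ∀ k, 1 ≤ k → k ≤ n → G.state k ω ≠ istar}

/-- The histories that do not visit `istar` at the times `1, …, n`. -/
def histAvoids (n : ℕ) : Set (G.Hist n) :=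
  {h | (∀ k : Fin n, 1 ≤ (k : ℕ) → (h.1 k).1.1.1 ≠ istar) ∧ (1 ≤ n → h.2 ≠ istar)}

theorem measurableSet_histAvoids (n : ℕ) : MeasurableSet (G.histAvoids istar n) := by
  have hst : Measurable fun x : G.Stage => x.1.1.1 :=
    measurable_fst.comp (measurable_subtype_coe.comp measurable_fst)
  refine MeasurableSet.inter (s₁ := {h : G.Hist n | ∀ k : Fin n, 1 ≤ (k : ℕ) →
    (h.1 k).1.1.1 ≠ istar}) (s₂ := {h : G.Hist n | 1 ≤ n → h.2 ≠ istar}) ?_ ?_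
  · simp only [ofPred_forall]
    refine MeasurableSet.iInter fun k => MeasurableSet.iInter fun _ => ?_
    exact ((measurableSet_singleton istar).preimage
      (hst.comp ((measurable_pi_apply k).comp measurable_fst))).compl
  · simp only [ofPred_forall]
    refine MeasurableSet.iInter fun _ => ?_
    exact ((measurableSet_singleton istar).preimage measurable_snd).compl

theorem measurableSet_avoids (n : ℕ) : MeasurableSet (G.avoids istar n) := by
  simp only [avoids, ofPred_forall]
  refine MeasurableSet.iInter fun k => MeasurableSet.iInter fun _ => MeasurableSet.iInter fun _ => ?_
  exact ((measurableSet_singleton istar).preimage (G.measurable_state k)).compl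

theorem hist_mem_histAvoids (n : ℕ) (ω : ℕ → G.Stage) :
    G.hist n ω ∈ G.histAvoids istar n ↔ ω ∈ G.avoids istar n := by
  constructor
  · rintro ⟨h1, h2⟩ k hk hkn
    rcases hkn.lt_or_eq with h | rfl
    · exact h1 ⟨k, h⟩ hk
    · exact h2 hk
  · exact fun h => ⟨fun k hk => h k hk k.2.le, fun hn => h n hn le_rfl⟩

theorem indicator_histAvoids (n : ℕ) (ω : ℕ → G.Stage) :
    (G.histAvoids istar n).indicator (1 : G.Hist n → ℝ≥0∞) (G.hist n ω) =
      (G.avoids istar n).indicator 1 ω := by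
  by_cases h : ω ∈ G.avoids istar n
  · rw [indicator_of_mem h, indicator_of_mem ((G.hist_mem_histAvoids istar n ω).2 h)]
    rfl
  · rw [indicator_of_notMem h,
      indicator_of_notMem fun h' => h ((G.hist_mem_histAvoids istar n ω).1 h')]

/-- The trajectories that return to `istar` for the first time at time `n + 1`. -/
def firstReturn (n : ℕ) : Set (ℕ → G.Stage) :=
  {ω | ω ∈ G.avoids istar n ∧ G.state (n + 1) ω = istar}

theorem measurableSet_firstReturn (n : ℕ) : MeasurableSet (G.firstReturn istar n) :=
  (G.measurableSet_avoids istar n).inter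
    ((measurableSet_singleton istar).preimage (G.measurable_state (n + 1)))

variable {istar} {ω : ℕ → G.Stage}

theorem avoids_succ_iff {n : ℕ} : ω ∈ G.avoids istar (n + 1) ↔
    ω ∈ G.avoids istar n ∧ G.state (n + 1) ω ≠ istar := by
  refine ⟨fun h => ⟨fun k hk hkn => h k hk (by omega), h _ (by omega) le_rfl⟩, ?_⟩
  rintro ⟨h1, h2⟩ k hk hkn
  rcases hkn.lt_or_eq with h | rfl
  · exact h1 k hk (by omega)
  · exact h2

theorem returnTime_eq_of_mem {n : ℕ} (h : ω ∈ G.firstReturn istar n) :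
    G.returnTime istar ω = ((n + 1 : ℕ) : WithTop ℕ) := by
  have hex : ∃ j, 1 ≤ j ∧ G.state j ω ∈ ({istar} : Set S) := ⟨n + 1, by omega, h.2⟩
  have hs : sInf {j : ℕ | 1 ≤ j ∧ G.state j ω ∈ ({istar} : Set S)} = n + 1 := by
    refine le_antisymm (Nat.sInf_le ⟨by omega, h.2⟩) (le_csInf hex ?_)
    rintro j ⟨hj1, hj2⟩
    by_contra hlt
    exact h.1 j hj1 (by omega) hj2
  rw [returnTime, hittingAfter, if_pos hex, hs]
  rfl

theorem returnTime_eq_top_iff : G.returnTime istar ω = ⊤ ↔ ∀ n, ω ∈ G.avoids istar n := by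
  rw [returnTime, hittingAfter_eq_top_iff]
  exact ⟨fun h n k hk _ => h k hk, fun h j hj => h j j hj le_rfl⟩

theorem exists_mem_firstReturn (h : G.returnTime istar ω ≠ ⊤) :
    ∃ n, ω ∈ G.firstReturn istar n := by
  by_contra! hc
  refine h (G.returnTime_eq_top_iff.2 fun n => ?_)
  induction n with
  | zero => intro k hk hk0; omega
  | succ n ih => exact G.avoids_succ_iff.2 ⟨ih, fun hs => hc n ⟨ih, hs⟩⟩

theorem le_of_mem_avoids_of_mem_firstReturn {m n : ℕ} (hm : ω ∈ G.avoids istar m)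
    (hn : ω ∈ G.firstReturn istar n) : m ≤ n := by
  by_contra! h
  exact hm (n + 1) (by omega) h hn.2

variable (istar) in
theorem pairwise_disjoint_firstReturn :
    Pairwise (Function.onFun Disjoint (G.firstReturn istar)) := by
  intro m n hmn
  refine Set.disjoint_left.2 fun ω hm hn => hmn ?_
  exact le_antisymm (G.le_of_mem_avoids_of_mem_firstReturn hm.1 hn)
    (G.le_of_mem_avoids_of_mem_firstReturn hn.1 hm)

variable (istar) in
theorem measurableSet_returnTime_eq_top : MeasurableSet {ω | G.returnTime istar ω = ⊤} := by
  simp_rw [returnTime_eq_top_iff, ofPred_forall]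
  exact MeasurableSet.iInter fun n => G.measurableSet_avoids istar n

/-- The product of a factor `γ` along the stages before the first return. -/
def returnProd (istar : S) (γ : G.K → ℝ≥0∞) (ω : ℕ → G.Stage) : ℝ≥0∞ :=
  ∏ k ∈ Finset.range ((G.returnTime istar ω).untopD 0), γ (ω k).1

variable {π₁ π₂ i}

/-- The variable $R^{\tau^*}$ is infinite where there is no return, so a finite moment forces
return. -/
theorem ae_returnTime_ne_top {R : ℝ}
    (hR : ∫⁻ ω, G.powReturnTime istar R ω ∂G.law π₁ π₂ i ≠ ∞) :
    ∀ᵐ ω ∂G.law π₁ π₂ i, G.returnTime istar ω ≠ ⊤ := by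
  rw [ae_iff]
  simp only [ne_eq, not_not]
  by_contra hpos
  refine hR (top_le_iff.1 ?_)
  calc ∞ = ∫⁻ ω, {ω | G.returnTime istar ω = ⊤}.indicator (fun _ => ∞) ω ∂G.law π₁ π₂ i := by
        rw [lintegral_indicator_const (G.measurableSet_returnTime_eq_top istar),
          ENNReal.top_mul hpos]
    _ ≤ _ := lintegral_mono fun ω => by
        by_cases h : G.returnTime istar ω = ⊤ <;> simp [indicator, h, powReturnTime]

theorem lintegral_returnProd {R : ℝ}
    (hR : ∫⁻ ω, G.powReturnTime istar R ω ∂G.law π₁ π₂ i ≠ ∞) (γ : G.K → ℝ≥0∞) :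
    ∫⁻ ω, G.returnProd istar γ ω ∂G.law π₁ π₂ i =
      ∑' n, ∫⁻ ω in G.firstReturn istar n, ∏ k ∈ Finset.range (n + 1), γ (ω k).1
        ∂G.law π₁ π₂ i := by
  have hU : ∀ᵐ ω ∂G.law π₁ π₂ i, ω ∈ ⋃ n, G.firstReturn istar n := by
    filter_upwards [G.ae_returnTime_ne_top hR] with ω hω
    exact mem_iUnion.2 (G.exists_mem_firstReturn hω)
  rw [← setLIntegral_univ, ← setLIntegral_congr (s := ⋃ n, G.firstReturn istar n)
    (eventuallyEq_univ.2 hU),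
    lintegral_iUnion (G.measurableSet_firstReturn istar) (G.pairwise_disjoint_firstReturn istar)]
  refine tsum_congr fun n => setLIntegral_congr_fun (G.measurableSet_firstReturn istar n) ?_
  intro ω hω
  simp only [returnProd, G.returnTime_eq_of_mem hω]
  rfl

/-- The return comes after the first $n$ stages, which is where $1\le R$ enters: $R^n\le
R^{\tau^*}$. -/
theorem prod_le_powReturnTime {R : ℝ} (hR1 : 1 ≤ R) {γ : G.K → ℝ≥0∞}
    (hγR : ∀ k, γ k ≤ ENNReal.ofReal R) {n : ℕ} (hω : ω ∈ G.avoids istar n) :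
    ∏ k ∈ Finset.range n, γ (ω k).1 ≤ G.powReturnTime istar R ω := by
  unfold powReturnTime
  split_ifs with h
  · exact le_top
  · obtain ⟨m, hm⟩ := G.exists_mem_firstReturn h
    rw [G.returnTime_eq_of_mem hm]
    have hnm := G.le_of_mem_avoids_of_mem_firstReturn hω hm
    calc ∏ k ∈ Finset.range n, γ (ω k).1 ≤ ∏ _k ∈ Finset.range n, ENNReal.ofReal R :=
          Finset.prod_le_prod' fun k _ => hγR _
      _ = ENNReal.ofReal R ^ n := by simp
      _ ≤ ENNReal.ofReal R ^ (m + 1) :=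
          pow_le_pow_right₀ (ENNReal.one_le_ofReal.2 hR1) (by omega)

theorem returnProd_le_powReturnTime {R : ℝ} {γ : G.K → ℝ≥0∞}
    (hγR : ∀ k, γ k ≤ ENNReal.ofReal R) : G.returnProd istar γ ω ≤ G.powReturnTime istar R ω := by
  unfold powReturnTime returnProd
  split_ifs with h
  · exact le_top
  · exact (Finset.prod_le_prod' fun k _ => hγR _).trans (by simp)

/-- `u` with its value at `istar` replaced by `1`. -/
def absorb (istar : S) (u : S → ℝ≥0∞) : S → ℝ≥0∞ :=
  open Classical in fun j => if j = istar then 1 else u j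

variable (istar) in
theorem absorb_mono {u v : S → ℝ≥0∞} (h : ∀ j, u j ≤ v j) (j : S) :
    absorb istar u j ≤ absorb istar v j := by
  unfold absorb; split_ifs; exacts [le_rfl, h j]

/-- A trajectory still running at time $n$ either enters `istar` at time $n+1$, where `absorb` pays
the terminal value $1$, or keeps running with value `u`. -/
theorem lintegral_avoids_succ {γ : G.K → ℝ≥0∞} (hγ : Measurable γ) (u : S → ℝ≥0∞) (n : ℕ) :
    ∫⁻ ω, (∏ k ∈ Finset.range (n + 1), γ (ω k).1) *
        (G.histAvoids istar n).indicator 1 (G.hist n ω) *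
        absorb istar u (G.state (n + 1) ω) ∂G.law π₁ π₂ i =
      ∫⁻ ω in G.firstReturn istar n, ∏ k ∈ Finset.range (n + 1), γ (ω k).1 ∂G.law π₁ π₂ i +
        ∫⁻ ω, (∏ k ∈ Finset.range (n + 1), γ (ω k).1) *
          (G.histAvoids istar (n + 1)).indicator 1 (G.hist (n + 1) ω) *
          u (G.state (n + 1) ω) ∂G.law π₁ π₂ i := by
  rw [← lintegral_indicator (G.measurableSet_firstReturn istar n), ← lintegral_add_left]
  · refine lintegral_congr fun ω => ?_
    simp only [indicator_histAvoids, absorb]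
    by_cases h1 : ω ∈ G.avoids istar n <;> by_cases h2 : G.state (n + 1) ω = istar <;>
      simp [h1, h2, indicator, avoids_succ_iff, firstReturn]
  · refine Measurable.indicator ?_ (G.measurableSet_firstReturn istar n)
    exact Finset.measurable_prod _ fun k _ =>
      hγ.comp (measurable_fst.comp (measurable_pi_apply k))

theorem tendsto_measure_avoids {R : ℝ}
    (hR : ∫⁻ ω, G.powReturnTime istar R ω ∂G.law π₁ π₂ i ≠ ∞) :
    Tendsto (fun n => G.law π₁ π₂ i (G.avoids istar n)) atTop (𝓝 0) := by
  have h := tendsto_measure_iInter_atTop (μ := G.law π₁ π₂ i) (s := G.avoids istar)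
    (fun n => (G.measurableSet_avoids istar n).nullMeasurableSet)
    (fun m n hmn ω hω k hk hkm => hω k hk (hkm.trans hmn)) ⟨0, measure_ne_top _ _⟩
  have h0 : G.law π₁ π₂ i (⋂ n, G.avoids istar n) = 0 := by
    have := G.ae_returnTime_ne_top hR
    rw [ae_iff] at this
    simp only [ne_eq, not_not, returnTime_eq_top_iff] at this
    convert this using 2
    ext ω
    simp
  rwa [h0] at h

variable {γ : G.K → ℝ≥0∞} {u : S → ℝ≥0∞}

/-- Stopping at $\tau^*$ a quantity that grows in mean. On the event of no return by time $n$ the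
remainder is at most $(\sum_j u_j)R^{\tau^*}$; since this is integrable and the events shrink to a
null set, the remainder tends to $0$. -/
theorem le_lintegral_returnProd {R : ℝ} (hR1 : 1 ≤ R)
    (hR : ∫⁻ ω, G.powReturnTime istar R ω ∂G.law π₁ π₂ i ≠ ∞) (hγ : Measurable γ)
    (hγR : ∀ k, γ k ≤ ENNReal.ofReal R) (hu : ∀ j, u j ≠ ∞)
    (hle : ∀ n (h : G.Hist n), u h.2 ≤
      G.stageOp γ (absorb istar u) (G.actionKernel π₁ π₂ n h)) :
    u i ≤ ∫⁻ ω, G.returnProd istar γ ω ∂G.law π₁ π₂ i := by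
  rw [G.lintegral_returnProd hR]
  set a : ℕ → ℝ≥0∞ := fun n => ∫⁻ ω, (∏ k ∈ Finset.range n, γ (ω k).1) *
    (G.histAvoids istar n).indicator 1 (G.hist n ω) * u (G.state n ω) ∂G.law π₁ π₂ i with ha
  have ha0 : a 0 = u i := by
    rw [← G.lintegral_law_state_zero π₁ π₂ i u]
    refine lintegral_congr fun ω => ?_
    have h0 : ω ∈ G.avoids istar 0 := fun k hk hk0 => by omega
    simp [indicator_histAvoids, h0]
  rw [← ha0]
  refine ENNReal.le_tsum_of_le_add_of_tendsto_zero (fun n => ?_) ?_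
  · rw [← G.lintegral_avoids_succ hγ u n]
    exact G.lintegral_law_le_succ π₁ π₂ i n (G.measurableSet_histAvoids istar n)
      (w := fun x => γ x.1) (hγ.comp measurable_fst) (fun k => by simp) (hle n)
  · have hC : ∑ j, u j ≠ ∞ := ENNReal.sum_ne_top.2 fun j _ => hu j
    have h1 : Tendsto (fun n => (∑ j, u j) * ∫⁻ ω in G.avoids istar n, G.powReturnTime istar R ω
        ∂G.law π₁ π₂ i) atTop (𝓝 ((∑ j, u j) * 0)) :=
      ENNReal.Tendsto.const_mul (tendsto_setLIntegral_zero hR (G.tendsto_measure_avoids hR))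
        (Or.inr hC)
    rw [mul_zero] at h1
    refine tendsto_of_tendsto_of_tendsto_of_le_of_le tendsto_const_nhds h1
      (fun _ => zero_le) fun n => ?_
    simp only [ha]
    rw [← lintegral_indicator (G.measurableSet_avoids istar n), ← lintegral_const_mul' _ _ hC]
    refine lintegral_mono fun ω => ?_
    by_cases h : ω ∈ G.avoids istar n
    · simp only [indicator_histAvoids, indicator_of_mem h, Pi.one_apply, mul_one]
      rw [mul_comm]
      exact mul_le_mul' (Finset.single_le_sum (f := u) (fun _ _ => zero_le) (Finset.mem_univ _))
        (G.prod_le_powReturnTime hR1 hγR h)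
    · simp [indicator_histAvoids, h]

/-- The stopped process decreases in mean, so the remainder can be dropped and `u` needs no bound.
-/
theorem lintegral_returnProd_le {R : ℝ}
    (hR : ∫⁻ ω, G.powReturnTime istar R ω ∂G.law π₁ π₂ i ≠ ∞) (hγ : Measurable γ)
    (hle : ∀ n (h : G.Hist n),
      G.stageOp γ (absorb istar u) (G.actionKernel π₁ π₂ n h) ≤ u h.2) :
    ∫⁻ ω, G.returnProd istar γ ω ∂G.law π₁ π₂ i ≤ u i := by
  rw [G.lintegral_returnProd hR]
  set a : ℕ → ℝ≥0∞ := fun n => ∫⁻ ω, (∏ k ∈ Finset.range n, γ (ω k).1) *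
    (G.histAvoids istar n).indicator 1 (G.hist n ω) * u (G.state n ω) ∂G.law π₁ π₂ i with ha
  have ha0 : a 0 = u i := by
    rw [← G.lintegral_law_state_zero π₁ π₂ i u]
    refine lintegral_congr fun ω => ?_
    have h0 : ω ∈ G.avoids istar 0 := fun k hk hk0 => by omega
    simp [indicator_histAvoids, h0]
  rw [← ha0]
  refine ENNReal.tsum_le_of_add_le fun n => ?_
  rw [← G.lintegral_avoids_succ hγ u n]
  exact G.lintegral_law_succ_le π₁ π₂ i n (G.measurableSet_histAvoids istar n)
    (w := fun x => γ x.1) (hγ.comp measurable_fst) (fun k => by simp) (hle n)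

end SemiMarkovGame

/-! ### The one-player problem until the return, and the choice of $g$ -/

namespace SemiMarkovGame

variable {S A B : Type*} [Fintype S] [MeasurableSpace S] [DiscreteMeasurableSpace S]
  [MeasurableSpace A] [MeasurableSpace B] (G : SemiMarkovGame S A B)

theorem measurable_returnTime_untopD (istar : S) :
    Measurable fun ω => (G.returnTime istar ω).untopD 0 := by
  refine measurable_to_countable' fun n => ?_
  cases n with
  | zero =>
    -- Returns occur at times $n+1\ge1$, so the default value $0$ of `untopD` singles out exactly
    -- the trajectories without return.
    convert G.measurableSet_returnTime_eq_top istar using 1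
    ext ω
    simp only [mem_preimage, mem_singleton_iff, mem_ofPred_eq]
    refine ⟨fun h => ?_, fun h => by rw [h]; rfl⟩
    by_contra hne
    obtain ⟨m, hm⟩ := G.exists_mem_firstReturn hne
    rw [G.returnTime_eq_of_mem hm] at h
    exact absurd h (Nat.succ_ne_zero m)
  | succ n =>
    convert G.measurableSet_firstReturn istar n using 1
    ext ω
    simp only [mem_preimage, mem_singleton_iff]
    refine ⟨fun h => ?_, fun h => by rw [G.returnTime_eq_of_mem h]; rfl⟩
    have hne : G.returnTime istar ω ≠ ⊤ := fun h' => by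
      rw [h'] at h
      exact absurd h (Nat.succ_ne_zero n).symm
    obtain ⟨m, hm⟩ := G.exists_mem_firstReturn hne
    rw [G.returnTime_eq_of_mem hm] at h
    have : m + 1 = n + 1 := h
    obtain rfl : m = n := by omega
    exact hm

theorem measurable_returnProd (istar : S) {γ : G.K → ℝ≥0∞} (hγ : Measurable γ) :
    Measurable (G.returnProd istar γ) := by
  have h : Measurable fun z : (ℕ → G.Stage) × ℕ => ∏ k ∈ Finset.range z.2, γ (z.1 k).1 :=
    measurable_from_prod_countable_left fun n => Finset.measurable_prod
      (Finset.range n) (f := fun k (ω : ℕ → G.Stage) => γ (ω k).1) fun k _ =>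
        hγ.comp (measurable_fst.comp (measurable_pi_apply k))
  exact h.comp (measurable_id.prodMk (G.measurable_returnTime_untopD istar))

/-- The one-player control problem behind a best response: `D i` is the set of laws on `𝕂` that the
player can choose in the state `i`, and `γ g` is the multiplicative cost of a stage when the cost
per unit of time is reduced by `g`. -/
structure IsControlProblem (D : S → Set (Measure G.K)) (γ : ℝ → G.K → ℝ≥0∞) (istar : S)
    (c L R : ℝ) : Prop where
  isProbabilityMeasure : ∀ i, ∀ μ ∈ D i, IsProbabilityMeasure μ
  measurable : ∀ g, Measurable (γ g)
  exists_min : ∀ g (u : S → ℝ≥0∞), (∀ j, u j ≠ ∞) → ∀ i, ∃ μ ∈ D i, ∀ ν ∈ D i,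
    G.stageOp (γ g) u μ ≤ G.stageOp (γ g) u ν
  nonneg : 0 ≤ c
  one_le : 1 ≤ R
  le_bound : ∀ g ∈ Icc (-c) c, ∀ k, γ g k ≤ ENNReal.ofReal R
  le_one : ∀ k, γ c k ≤ 1
  one_le_neg : ∀ k, 1 ≤ γ (-c) k
  le_exp_mul : ∀ g g' k, γ g' k ≤ ENNReal.ofReal (Real.exp (L * |g - g'|)) * γ g k
  lip_nonneg : 0 ≤ L
  exists_stat : ∀ d : S → Measure G.K, (∀ i, d i ∈ D i) → ∃ (φ₁ : G.Stat₁) (φ₂ : G.Stat₂),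
    ∀ n h, G.actionKernel (StationaryPolicy.toPolicy G φ₁) (StationaryPolicy.toPolicy G φ₂) n h =
      d h.2
  return_ne_top : ∀ (φ₁ : G.Stat₁) (φ₂ : G.Stat₂) (i : S),
    ∫⁻ ω, G.powReturnTime istar R ω ∂(G.statLaw φ₁ φ₂ i) ≠ ∞

/-- The iterates, from `0`, of the dynamic programming operator for the multiplicative cost until
the return to `istar`. -/
def valueIter (D : S → Set (Measure G.K)) (γ : G.K → ℝ≥0∞) (istar : S) : ℕ → S → ℝ≥0∞
  | 0 => fun _ => 0
  | n + 1 => fun i => ⨅ μ ∈ D i, G.stageOp γ (absorb istar (valueIter D γ istar n)) μ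

/-- The minimal multiplicative cost until the return to `istar`. -/
def value (D : S → Set (Measure G.K)) (γ : G.K → ℝ≥0∞) (istar : S) (i : S) : ℝ≥0∞ :=
  ⨆ n, G.valueIter D γ istar n i

variable {D : S → Set (Measure G.K)} {γ : ℝ → G.K → ℝ≥0∞} {istar : S}

theorem monotone_valueIter (γ : G.K → ℝ≥0∞) (i : S) :
    Monotone fun n => G.valueIter D γ istar n i := by
  refine monotone_nat_of_le_succ fun n => ?_
  induction n generalizing i with
  | zero => exact zero_le
  | succ n ih =>
    exact iInf₂_mono fun μ _ => G.stageOp_mono (fun _ => le_rfl) (absorb_mono istar ih) μ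

theorem absorb_ne_top {u : S → ℝ≥0∞} (hu : ∀ j, u j ≠ ∞) (j : S) : absorb istar u j ≠ ∞ := by
  unfold absorb; split_ifs; exacts [ENNReal.one_ne_top, hu j]

theorem stageOp_ne_top {γ : G.K → ℝ≥0∞} {c : ℝ≥0∞} (hc : c ≠ ∞) (hγ : ∀ k, γ k ≤ c)
    {u : S → ℝ≥0∞} (hu : ∀ j, u j ≠ ∞) (μ : Measure G.K) [IsProbabilityMeasure μ] :
    G.stageOp γ u μ ≠ ∞ := by
  have h1 : G.stageOp γ u μ ≤ G.stageOp γ (fun _ => ∑ j, u j) μ :=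
    G.stageOp_mono (fun _ => le_rfl)
      (fun j => Finset.single_le_sum (f := u) (fun _ _ => zero_le) (Finset.mem_univ j)) μ
  exact ne_top_of_le_ne_top (ENNReal.mul_ne_top hc (ENNReal.sum_ne_top.2 fun j _ => hu j))
    (h1.trans (G.stageOp_const_le hγ _ μ))

namespace IsControlProblem

variable {G} {c L R : ℝ} (H : G.IsControlProblem D γ istar c L R)

include H

theorem nonempty (i : S) : (D i).Nonempty := by
  obtain ⟨μ, hμ, -⟩ := H.exists_min 0 (fun _ => 0) (by simp) i
  exact ⟨μ, hμ⟩

variable {g : ℝ} (hg : g ∈ Icc (-c) c)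

include hg

theorem valueIter_ne_top (n : ℕ) (i : S) : G.valueIter D (γ g) istar n i ≠ ∞ := by
  induction n generalizing i with
  | zero => exact ENNReal.zero_ne_top
  | succ n ih =>
    obtain ⟨μ, hμ⟩ := H.nonempty i
    have := H.isProbabilityMeasure i μ hμ
    exact ne_top_of_le_ne_top (G.stageOp_ne_top ENNReal.ofReal_ne_top (H.le_bound g hg)
      (absorb_ne_top ih) μ) (iInf₂_le μ hμ)

/-- Every value iterate lies below the next one, hence below the stage operator applied to itself;
each is therefore a subsolution to which `le_lintegral_returnProd` applies. -/
theorem value_le_lintegral {φ₁ : G.Stat₁} {φ₂ : G.Stat₂} {d : S → Measure G.K}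
    (hd : ∀ i, d i ∈ D i) (hφ : ∀ n h, G.actionKernel (StationaryPolicy.toPolicy G φ₁)
      (StationaryPolicy.toPolicy G φ₂) n h = d h.2) (i : S) :
    G.value D (γ g) istar i ≤ ∫⁻ ω, G.returnProd istar (γ g) ω ∂G.statLaw φ₁ φ₂ i := by
  refine iSup_le fun n => ?_
  refine G.le_lintegral_returnProd H.one_le (H.return_ne_top φ₁ φ₂ i) (H.measurable g)
    (H.le_bound g hg) (H.valueIter_ne_top hg n) fun m h => ?_
  rw [hφ]
  exact (G.monotone_valueIter (γ g) h.2 n.le_succ).trans (iInf₂_le _ (hd h.2))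

/-- Any selection from `D` gives a finite upper bound, because its cost is dominated by
$R^{\tau^*}$. -/
theorem value_ne_top (i : S) : G.value D (γ g) istar i ≠ ∞ := by
  choose d hd using H.nonempty
  obtain ⟨φ₁, φ₂, hφ⟩ := H.exists_stat d hd
  refine ne_top_of_le_ne_top (H.return_ne_top φ₁ φ₂ i) ((H.value_le_lintegral hg hd hφ i).trans ?_)
  exact lintegral_mono fun ω => G.returnProd_le_powReturnTime (H.le_bound g hg)

theorem value_le_stageOp (i : S) {μ : Measure G.K} (hμ : μ ∈ D i) :
    G.value D (γ g) istar i ≤ G.stageOp (γ g) (absorb istar (G.value D (γ g) istar)) μ := by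
  refine iSup_le fun n => (G.monotone_valueIter (γ g) i n.le_succ).trans ((iInf₂_le μ hμ).trans ?_)
  exact G.stageOp_mono (fun _ => le_rfl) (absorb_mono istar fun j =>
    le_iSup (fun n => G.valueIter D (γ g) istar n j) n) μ

/-- Convergence of the iterates is uniform because the state space is finite. -/
theorem exists_valueIter_add_le {ε : ℝ≥0∞} (hε : ε ≠ 0) :
    ∃ n, ∀ j, G.value D (γ g) istar j ≤ G.valueIter D (γ g) istar n j + ε := by
  have h : ∀ j, ∀ᶠ n in atTop,
      G.value D (γ g) istar j ≤ G.valueIter D (γ g) istar n j + ε := fun j => by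
    have ht : Tendsto (fun n => G.valueIter D (γ g) istar n j + ε) atTop
        (𝓝 (G.value D (γ g) istar j + ε)) :=
      (tendsto_atTop_iSup (G.monotone_valueIter (γ g) j)).add tendsto_const_nhds
    filter_upwards [ht.eventually_const_lt
      (ENNReal.lt_add_right (H.value_ne_top hg j) hε)] with n hn using hn.le
  exact (eventually_all.2 h).exists

/-- A stationary selection that attains the minimal cost. -/
theorem exists_stageOp_eq_value : ∃ d : S → Measure G.K, (∀ i, d i ∈ D i) ∧
    ∀ i, G.stageOp (γ g) (absorb istar (G.value D (γ g) istar)) (d i) =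
      G.value D (γ g) istar i := by
  choose d hd hmin using H.exists_min g (absorb istar (G.value D (γ g) istar))
    (absorb_ne_top (H.value_ne_top hg))
  refine ⟨d, hd, fun i => le_antisymm ?_ (H.value_le_stageOp hg i (hd i))⟩
  have hR0 : ENNReal.ofReal R ≠ 0 :=
    (ENNReal.ofReal_pos.2 (zero_lt_one.trans_le H.one_le)).ne'
  -- Infimum and increasing limit are exchanged by uniform approximation: an error $\varepsilon/R$
  -- in the value becomes at most $\varepsilon$ after one stage, simultaneously for all laws in `D
  -- i`.
  refine ENNReal.le_of_forall_pos_le_add fun ε hε _ => ?_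
  have hε' : (ε : ℝ≥0∞) / ENNReal.ofReal R ≠ 0 :=
    ENNReal.div_ne_zero.2 ⟨by exact_mod_cast hε.ne', ENNReal.ofReal_ne_top⟩
  obtain ⟨n, hn⟩ := H.exists_valueIter_add_le hg hε'
  have habs : ∀ j, absorb istar (G.value D (γ g) istar) j ≤
      absorb istar (G.valueIter D (γ g) istar n) j + ε / ENNReal.ofReal R := fun j => by
    unfold absorb
    split_ifs
    exacts [le_self_add, hn j]
  have key : ∀ μ ∈ D i, G.stageOp (γ g) (absorb istar (G.value D (γ g) istar)) (d i) ≤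
      G.stageOp (γ g) (absorb istar (G.valueIter D (γ g) istar n)) μ + ε := fun μ hμ => by
    have := H.isProbabilityMeasure i μ hμ
    calc G.stageOp (γ g) (absorb istar (G.value D (γ g) istar)) (d i)
        ≤ G.stageOp (γ g) (absorb istar (G.value D (γ g) istar)) μ := hmin i μ hμ
      _ ≤ G.stageOp (γ g) (fun j => absorb istar (G.valueIter D (γ g) istar n) j +
            ε / ENNReal.ofReal R) μ := G.stageOp_mono (fun _ => le_rfl) habs μ
      _ ≤ G.stageOp (γ g) (absorb istar (G.valueIter D (γ g) istar n)) μ +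
            ENNReal.ofReal R * (ε / ENNReal.ofReal R) :=
          G.stageOp_add_const_le (H.measurable g) (H.le_bound g hg) _ _ μ
      _ = _ := by rw [ENNReal.mul_div_cancel hR0 ENNReal.ofReal_ne_top]
  have h2 : G.stageOp (γ g) (absorb istar (G.value D (γ g) istar)) (d i) ≤
      G.valueIter D (γ g) istar (n + 1) i + ε := by
    rw [valueIter]
    obtain ⟨μ, hμ, hμmin⟩ := H.exists_min g (absorb istar (G.valueIter D (γ g) istar n))
      (absorb_ne_top (H.valueIter_ne_top hg n)) i
    exact (key μ hμ).trans (add_le_add (le_iInf₂ hμmin) le_rfl)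
  exact h2.trans (add_le_add (le_iSup (fun n => G.valueIter D (γ g) istar n i) (n + 1)) le_rfl)

/-- The minimal cost is attained by a pair of stationary policies. -/
theorem exists_value_eq_lintegral : ∃ (φ₁ : G.Stat₁) (φ₂ : G.Stat₂) (d : S → Measure G.K),
    (∀ i, d i ∈ D i) ∧ (∀ n h, G.actionKernel (StationaryPolicy.toPolicy G φ₁)
      (StationaryPolicy.toPolicy G φ₂) n h = d h.2) ∧
    ∀ i, G.value D (γ g) istar i = ∫⁻ ω, G.returnProd istar (γ g) ω ∂G.statLaw φ₁ φ₂ i := by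
  obtain ⟨d, hd, hval⟩ := H.exists_stageOp_eq_value hg
  obtain ⟨φ₁, φ₂, hφ⟩ := H.exists_stat d hd
  refine ⟨φ₁, φ₂, d, hd, hφ, fun i => le_antisymm (H.value_le_lintegral hg hd hφ i) ?_⟩
  refine G.lintegral_returnProd_le (H.return_ne_top φ₁ φ₂ i) (H.measurable g) fun m h => ?_
  rw [hφ, hval]

omit hg in
theorem one_le_value (i : S) : 1 ≤ G.value D (γ (-c)) istar i := by
  have hc : -c ∈ Icc (-c) c := ⟨le_rfl, by linarith [H.nonneg]⟩
  obtain ⟨φ₁, φ₂, d, -, -, hval⟩ := H.exists_value_eq_lintegral hc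
  rw [hval i]
  have : IsProbabilityMeasure (G.statLaw φ₁ φ₂ i) := by unfold statLaw; infer_instance
  calc (1 : ℝ≥0∞) = ∫⁻ _, 1 ∂G.statLaw φ₁ φ₂ i := by simp
    _ ≤ _ := lintegral_mono fun ω => Finset.one_le_prod' fun k _ => H.one_le_neg _

omit hg in
theorem value_le_one (i : S) : G.value D (γ c) istar i ≤ 1 := by
  refine iSup_le fun n => ?_
  induction n generalizing i with
  | zero => exact zero_le
  | succ n ih =>
    obtain ⟨μ, hμ⟩ := H.nonempty i
    have := H.isProbabilityMeasure i μ hμ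
    refine (iInf₂_le μ hμ).trans ?_
    calc _ ≤ G.stageOp (γ c) (fun _ => 1) μ := G.stageOp_mono (fun _ => le_rfl) (fun j => by
            unfold absorb; split_ifs; exacts [le_rfl, ih j]) μ
      _ ≤ 1 * 1 := G.stageOp_const_le H.le_one 1 μ
      _ = 1 := one_mul 1

omit hg in
-- Changing $g$ alters a factor by a bounded ratio, and at $-c$ the factor is at least $1$.
theorem stage_ne_zero (g : ℝ) (k : G.K) : γ g k ≠ 0 := fun h => by
  have h1 := (H.one_le_neg k).trans (H.le_exp_mul g (-c) k)
  rw [h, mul_zero] at h1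
  exact absurd h1 (by simp)

theorem value_ne_zero (i : S) : G.value D (γ g) istar i ≠ 0 := by
  obtain ⟨φ₁, φ₂, d, -, -, hval⟩ := H.exists_value_eq_lintegral hg
  have : IsProbabilityMeasure (G.statLaw φ₁ φ₂ i) := by unfold statLaw; infer_instance
  rw [hval i, ← pos_iff_ne_zero,
    lintegral_pos_iff_support (G.measurable_returnProd istar (H.measurable g))]
  have : Function.support (G.returnProd istar (γ g)) = univ :=
    eq_univ_of_forall fun ω => Finset.prod_ne_zero_iff.2 fun k _ => H.stage_ne_zero g _
  rw [this, measure_univ]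
  exact one_pos

omit hg in
theorem one_le_exp (g g' : ℝ) : 1 ≤ ENNReal.ofReal (Real.exp (L * |g - g'|)) :=
  ENNReal.one_le_ofReal.2 (Real.one_le_exp (mul_nonneg H.lip_nonneg (abs_nonneg _)))

omit hg in
-- The $n$-th iterate involves at most $n$ stages, and each contributes one factor $e^{L|g-g'|}$.
theorem valueIter_le_exp_mul (g g' : ℝ) (n : ℕ) (i : S) : G.valueIter D (γ g') istar n i ≤
    ENNReal.ofReal (Real.exp (L * |g - g'|)) ^ n * G.valueIter D (γ g) istar n i := by
  set E := ENNReal.ofReal (Real.exp (L * |g - g'|)) with hE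
  have hE0 : E ≠ 0 := (zero_lt_one.trans_le (H.one_le_exp g g')).ne'
  have hEt : E ≠ ∞ := ENNReal.ofReal_ne_top
  induction n generalizing i with
  | zero => simp [valueIter]
  | succ n ih =>
    rw [valueIter, valueIter, ENNReal.mul_iInf_of_ne (pow_ne_zero _ hE0) (ENNReal.pow_ne_top hEt)]
    refine iInf_mono fun μ => ?_
    rw [ENNReal.mul_iInf_of_ne (pow_ne_zero _ hE0) (ENNReal.pow_ne_top hEt)]
    refine iInf_mono fun hμ => ?_
    rw [pow_succ', mul_assoc, ← G.stageOp_mul_const (γ g) (H.measurable g),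
      ← G.stageOp_const_mul (γ g) (H.measurable g)]
    refine G.stageOp_mono (H.le_exp_mul g g') (fun j => ?_) μ
    -- At `istar` the terminal value is $1$ on both sides, and the extra power is at least $1$.
    unfold absorb
    split_ifs
    · rw [mul_one]
      exact one_le_pow₀ (H.one_le_exp g g')
    · exact ih j

omit hg in
theorem returnProd_le_exp_mul (g g' : ℝ) (ω : ℕ → G.Stage) : G.returnProd istar (γ g') ω ≤
    ENNReal.ofReal (Real.exp (L * |g - g'|)) ^ ((G.returnTime istar ω).untopD 0) *
      G.returnProd istar (γ g) ω := by
  unfold returnProd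
  refine (Finset.prod_le_prod' fun k _ => H.le_exp_mul g g' (ω k).1).trans ?_
  simp [Finset.prod_mul_distrib]

omit H hg in
theorem tendsto_exp_pow (L g : ℝ) (n : ℕ) :
    Tendsto (fun g' => ENNReal.ofReal (Real.exp (L * |g - g'|)) ^ n) (𝓝 g) (𝓝 1) := by
  have h : Continuous fun g' => ENNReal.ofReal (Real.exp (L * |g - g'|)) ^ n := by
    refine (ENNReal.continuous_pow n).comp (ENNReal.continuous_ofReal.comp ?_)
    fun_prop
  have h1 := h.tendsto g
  simpa using h1

omit hg in
-- Along a fixed trajectory the number of factors is finite and independent of $g$; the ratio bound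
-- in both directions squeezes the product.
theorem tendsto_returnProd (g : ℝ) (ω : ℕ → G.Stage) :
    Tendsto (fun g' => G.returnProd istar (γ g') ω) (𝓝 g) (𝓝 (G.returnProd istar (γ g) ω)) := by
  have ht := tendsto_exp_pow L g ((G.returnTime istar ω).untopD 0)
  have h1 := ENNReal.Tendsto.mul_const (b := G.returnProd istar (γ g) ω) ht (Or.inl one_ne_zero)
  have h2 := ENNReal.Tendsto.const_div (a := G.returnProd istar (γ g) ω) ht
    (Or.inl ENNReal.one_ne_top)
  rw [one_mul] at h1
  rw [div_one] at h2
  refine tendsto_of_tendsto_of_tendsto_of_le_of_le h2 h1 (fun g' => ?_)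
    (fun g' => H.returnProd_le_exp_mul g g' ω)
  refine ENNReal.div_le_of_le_mul' ?_
  have := H.returnProd_le_exp_mul g' g ω
  rwa [abs_sub_comm] at this

omit hg in
/-- For a suitable `g` the minimal multiplicative cost of an excursion from `istar` is `1`. -/
theorem exists_value_eq_one : ∃ g ∈ Icc (-c) c, G.value D (γ g) istar istar = 1 := by
  set T : Set ℝ := {g | g ∈ Icc (-c) c ∧ G.value D (γ g) istar istar ≤ 1} with hT
  have hcc : -c ≤ c := by linarith [H.nonneg]
  have hcT : c ∈ T := ⟨⟨hcc, le_rfl⟩, H.value_le_one istar⟩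
  have hbdd : BddBelow T := ⟨-c, fun g hg => hg.1.1⟩
  have hmem : sInf T ∈ Icc (-c) c :=
    ⟨le_csInf ⟨c, hcT⟩ fun g hg => hg.1.1, csInf_le hbdd hcT⟩
  refine ⟨sInf T, hmem, le_antisymm (iSup_le fun n => ?_) ?_⟩
  -- Upper bound: for fixed $n$ the iterate at $\inf T$ is at most $e^{nL|x_m-\inf T|}$ times the
  -- one at $x_m\in T$, and the latter is at most $1$. Let $m\to\infty$ before taking the supremum
  -- over $n$.
  · obtain ⟨x, -, hx, hxT⟩ := exists_seq_tendsto_sInf ⟨c, hcT⟩ hbdd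
    refine ge_of_tendsto' ((tendsto_exp_pow L (sInf T) n).comp hx) fun m => ?_
    refine (H.valueIter_le_exp_mul (x m) (sInf T) n istar).trans ?_
    rw [abs_sub_comm]
    refine (mul_le_mul' le_rfl ((le_iSup (fun n => G.valueIter D (γ (x m)) istar n istar) n).trans
      (hxT m).2)).trans ?_
    rw [mul_one]
    rfl
  -- Lower bound: keep the policy that is optimal at $\inf T$ and move $g$ slightly to the left. By
  -- dominated convergence its cost stays below $1$, which puts a smaller $g$ into $T$. There is
  -- room on the left because the value at $-c$ is at least $1$.
  · by_contra! hlt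
    obtain ⟨φ₁, φ₂, d, hd, hφ, hval⟩ := H.exists_value_eq_lintegral hmem
    have hne : -c < sInf T := lt_of_le_of_ne hmem.1 fun h => by
      rw [← h] at hlt
      exact (H.one_le_value istar).not_gt hlt
    have hev : ∀ᶠ g in 𝓝[<] (sInf T), g ∈ Icc (-c) c := by
      filter_upwards [Ioo_mem_nhdsLT hne] with g hg using ⟨hg.1.le, hg.2.le.trans hmem.2⟩
    have hlim : Tendsto (fun g => ∫⁻ ω, G.returnProd istar (γ g) ω ∂G.statLaw φ₁ φ₂ istar)
        (𝓝[<] (sInf T)) (𝓝 (∫⁻ ω, G.returnProd istar (γ (sInf T)) ω ∂G.statLaw φ₁ φ₂ istar)) := by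
      refine tendsto_lintegral_filter_of_dominated_convergence (G.powReturnTime istar R)
        (Eventually.of_forall fun g => G.measurable_returnProd istar (H.measurable g)) ?_
        (H.return_ne_top φ₁ φ₂ istar)
        (Eventually.of_forall fun ω => (H.tendsto_returnProd _ ω).mono_left nhdsWithin_le_nhds)
      filter_upwards [hev] with g hg
      exact Eventually.of_forall fun ω => G.returnProd_le_powReturnTime (H.le_bound g hg)
    rw [← hval istar] at hlim
    obtain ⟨g, ⟨hg1, hg2⟩, hg3⟩ := ((hlim.eventually_lt_const hlt).and hev |>.and
      self_mem_nhdsWithin).exists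
    exact (csInf_le hbdd ⟨hg2, (H.value_le_lintegral hg2 hd hφ istar).trans hg1.le⟩).not_gt hg3

omit hg in
/-- The multiplicative optimality equation. -/
theorem exists_optimality_equation : ∃ g ∈ Icc (-c) c, ∃ u : S → ℝ≥0∞,
    u istar = 1 ∧ (∀ j, u j ≠ 0) ∧ (∀ j, u j ≠ ∞) ∧
    (∀ i, ∀ μ ∈ D i, u i ≤ G.stageOp (γ g) u μ) ∧
    ∃ d : S → Measure G.K, (∀ i, d i ∈ D i) ∧ ∀ i, G.stageOp (γ g) u (d i) = u i := by
  obtain ⟨g, hg, h1⟩ := H.exists_value_eq_one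
  -- With value $1$ at `istar` absorption has no effect, and the return equation becomes the full
  -- optimality equation.
  have habs : absorb istar (G.value D (γ g) istar) = G.value D (γ g) istar := by
    ext j
    unfold absorb
    split_ifs with h
    · rw [h, h1]
    · rfl
  obtain ⟨d, hd, hval⟩ := H.exists_stageOp_eq_value hg
  have hle := fun i μ => H.value_le_stageOp hg i (μ := μ)
  rw [habs] at hval hle
  exact ⟨g, hg, G.value D (γ g) istar, h1, H.value_ne_zero hg, H.value_ne_top hg, hle, d, hd, hval⟩

end IsControlProblem

end SemiMarkovGame

/-! ### Exponential growth rates -/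

section GrowthRate

variable {θ g : ℝ} {E : ℝ → ℝ≥0∞} {C : ℝ≥0∞}

theorem tendsto_growth_rate (hθ : 0 < θ) (g C : ℝ) :
    Tendsto (fun t : ℝ => (((1 / (θ * t)) * (C + θ * g * t) : ℝ) : EReal)) atTop (𝓝 (g : EReal)) := by
  refine (continuous_coe_real_ereal.tendsto g).comp ?_
  have h1 : Tendsto (fun t : ℝ => C / θ * t⁻¹ + g) atTop (𝓝 (C / θ * 0 + g)) :=
    (tendsto_inv_atTop_zero.const_mul _).add tendsto_const_nhds
  rw [mul_zero, zero_add] at h1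
  refine h1.congr' ?_
  filter_upwards [eventually_gt_atTop 0] with t ht
  field_simp

theorem mul_log_mul_exp (hC0 : C ≠ 0) (hC : C ≠ ∞) (a b : ℝ) :
    (a : EReal) * ENNReal.log (C * ENNReal.ofReal (Real.exp b)) =
      ((a * (Real.log C.toReal + b) : ℝ) : EReal) := by
  have hpos : 0 < C.toReal := ENNReal.toReal_pos hC0 hC
  nth_rw 1 [← ENNReal.ofReal_toReal hC]
  rw [← ENNReal.ofReal_mul hpos.le, ENNReal.log_ofReal_of_pos (mul_pos hpos (Real.exp_pos b)),
    Real.log_mul hpos.ne' (Real.exp_pos b).ne', Real.log_exp]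
  norm_cast

/-- A factor that does not depend on $t$ contributes $O(1/t)$ to the normalized logarithm. -/
theorem limsup_growth_le (hθ : 0 < θ) (hC0 : C ≠ 0) (hC : C ≠ ∞)
    (h : ∀ t, 0 < t → E t ≤ C * ENNReal.ofReal (Real.exp (θ * g * t))) :
    limsup (fun t : ℝ => ((1 / (θ * t) : ℝ) : EReal) * ENNReal.log (E t)) atTop ≤ g := by
  rw [← (tendsto_growth_rate hθ g (Real.log C.toReal)).limsup_eq]
  refine limsup_le_limsup ?_
  filter_upwards [eventually_gt_atTop 0] with t ht
  rw [← mul_log_mul_exp hC0 hC]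
  refine mul_le_mul_of_nonneg_left (ENNReal.log_monotone (h t ht)) ?_
  exact_mod_cast (by positivity : (0 : ℝ) ≤ 1 / (θ * t))

theorem le_limsup_growth (hθ : 0 < θ) (hC0 : C ≠ 0) (hC : C ≠ ∞)
    (h : ∀ t, 0 < t → C * ENNReal.ofReal (Real.exp (θ * g * t)) ≤ E t) :
    g ≤ limsup (fun t : ℝ => ((1 / (θ * t) : ℝ) : EReal) * ENNReal.log (E t)) atTop := by
  rw [← (tendsto_growth_rate hθ g (Real.log C.toReal)).limsup_eq]
  refine limsup_le_limsup ?_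
  filter_upwards [eventually_gt_atTop 0] with t ht
  rw [← mul_log_mul_exp hC0 hC]
  refine mul_le_mul_of_nonneg_left (ENNReal.log_monotone (h t ht)) ?_
  exact_mod_cast (by positivity : (0 : ℝ) ≤ 1 / (θ * t))

end GrowthRate

/-! ### Jump times, non-explosion and the cost up to time $t$ -/

namespace SemiMarkovGame

variable {S A B : Type*} [Fintype S] [MeasurableSpace S] [DiscreteMeasurableSpace S]
  [MeasurableSpace A] [MeasurableSpace B] (G : SemiMarkovGame S A B)
  (π₁ : G.Policy₁) (π₂ : G.Policy₂) (i : S)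

theorem measurable_sojourn (n : ℕ) : Measurable fun ω : ℕ → G.Stage => ((ω n).2 : ℝ) :=
  measurable_subtype_coe.comp (measurable_snd.comp (measurable_pi_apply n))

theorem measurable_jumpTime (n : ℕ) : Measurable (G.jumpTime n) :=
  Finset.measurable_sum _ fun k _ => G.measurable_sojourn k

theorem jumpTime_succ (n : ℕ) (ω : ℕ → G.Stage) :
    G.jumpTime (n + 1) ω = G.jumpTime n ω + ((ω n).2 : ℝ) := Finset.sum_range_succ _ _

theorem strictMono_jumpTime (ω : ℕ → G.Stage) : StrictMono fun n => G.jumpTime n ω :=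
  strictMono_nat_of_lt_succ fun n => by
    simp only [jumpTime_succ]
    exact lt_add_of_pos_right _ (ω n).2.2

theorem ae_sojourn_le {β : ℝ} (hβ : ∀ k, G.sojourn k {s | (s : ℝ) ≤ β} = 1) :
    ∀ᵐ ω ∂G.law π₁ π₂ i, ∀ n, ((ω n).2 : ℝ) ≤ β := by
  rw [ae_all_iff]
  intro n
  have hs : MeasurableSet {s : Ioi (0 : ℝ) | ¬ (s : ℝ) ≤ β} :=
    (measurableSet_Iic.preimage measurable_subtype_coe).compl
  have hx : MeasurableSet {x : G.Stage | ¬ (x.2 : ℝ) ≤ β} := hs.preimage measurable_snd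
  have h0 : ∀ k, G.sojourn k {s | ¬ (s : ℝ) ≤ β} = 0 := fun k => by
    exact (prob_compl_eq_zero_iff (measurableSet_Iic.preimage measurable_subtype_coe)).2 (hβ k)
  have h := G.lintegral_law_one_step π₁ π₂ i n (F := fun _ => 1) measurable_const
    (w := {x : G.Stage | ¬ (x.2 : ℝ) ≤ β}.indicator 1) (measurable_one.indicator hx) (fun _ => 1)
  have h1 : ∀ k, ∫⁻ s, {x : G.Stage | ¬ (x.2 : ℝ) ≤ β}.indicator (1 : G.Stage → ℝ≥0∞) (k, s)
      ∂G.sojourn k = 0 := fun k => by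
    rw [← h0 k, ← lintegral_indicator_one hs]
    rfl
  simp only [h1, one_mul, mul_one, zero_mul, lintegral_zero] at h
  rw [ae_iff]
  have hm : MeasurableSet {ω : ℕ → G.Stage | ¬ ((ω n).2 : ℝ) ≤ β} :=
    (measurableSet_Iic.preimage (G.measurable_sojourn n)).compl
  rw [← lintegral_indicator_one hm]
  exact h

/-- Exponential Markov inequality: on $\{T_n\le t\}$ one has $1\le e^{t-T_n}$, and each stage
contributes at most $q$ to $\mathbb E[e^{-T_n}]$. -/
theorem measure_jumpTime_le {q : ℝ≥0∞}
    (hq : ∀ k, ∫⁻ s, ENNReal.ofReal (Real.exp (-(s : ℝ))) ∂G.sojourn k ≤ q) (t : ℝ) (n : ℕ) :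
    G.law π₁ π₂ i {ω | G.jumpTime n ω ≤ t} ≤ ENNReal.ofReal (Real.exp t) * q ^ n := by
  set w : G.Stage → ℝ≥0∞ := fun x => ENNReal.ofReal (Real.exp (-(x.2 : ℝ))) with hw
  have hwm : Measurable w := ENNReal.measurable_ofReal.comp (Real.measurable_exp.comp
    (measurable_subtype_coe.comp measurable_snd).neg)
  have h1 : ∫⁻ ω, ∏ k ∈ Finset.range n, w (ω k) ∂G.law π₁ π₂ i ≤ q ^ n := by
    induction n with
    | zero => simp
    | succ n ih =>
      have h := G.lintegral_law_stageOp π₁ π₂ i n MeasurableSet.univ hwm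
        (γ := fun k => ∫⁻ s, w (k, s) ∂G.sojourn k) (fun k => rfl) (fun _ => 1)
      simp only [indicator_univ, Pi.one_apply, mul_one] at h
      rw [h]
      calc _ ≤ ∫⁻ ω, (∏ k ∈ Finset.range n, w (ω k)) * q ∂G.law π₁ π₂ i :=
            lintegral_mono fun ω => mul_le_mul' le_rfl
              ((G.stageOp_const_le hq 1 _).trans (mul_one q).le)
        _ = (∫⁻ ω, ∏ k ∈ Finset.range n, w (ω k) ∂G.law π₁ π₂ i) * q := by
            rw [lintegral_mul_const]
            exact Finset.measurable_prod _ fun k _ => hwm.comp (measurable_pi_apply k)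
        _ ≤ q ^ n * q := mul_le_mul' ih le_rfl
        _ = q ^ (n + 1) := (pow_succ q n).symm
  have h2 : ∀ ω : ℕ → G.Stage, ∏ k ∈ Finset.range n, w (ω k) =
      ENNReal.ofReal (Real.exp (-G.jumpTime n ω)) := fun ω => by
    rw [jumpTime, ← Finset.sum_neg_distrib, Real.exp_sum,
      ENNReal.ofReal_prod_of_nonneg fun _ _ => (Real.exp_pos _).le]
  have hm : MeasurableSet {ω | G.jumpTime n ω ≤ t} :=
    measurableSet_Iic.preimage (G.measurable_jumpTime n)
  rw [← lintegral_indicator_one hm]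
  refine le_trans ?_ (mul_le_mul' le_rfl h1)
  rw [← lintegral_const_mul' _ _ ENNReal.ofReal_ne_top]
  refine lintegral_mono fun ω => ?_
  by_cases h : G.jumpTime n ω ≤ t
  · simp only [h2, ← ENNReal.ofReal_mul (Real.exp_pos t).le, ← Real.exp_add]
    rw [indicator_of_mem (by exact h), Pi.one_apply]
    exact ENNReal.one_le_ofReal.2 (Real.one_le_exp (by linarith))
  · simp [h]

theorem tendsto_measure_jumpTime_le {q : ℝ≥0∞} (hq1 : q < 1)
    (hq : ∀ k, ∫⁻ s, ENNReal.ofReal (Real.exp (-(s : ℝ))) ∂G.sojourn k ≤ q) (t : ℝ) :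
    Tendsto (fun n => G.law π₁ π₂ i {ω | G.jumpTime n ω ≤ t}) atTop (𝓝 0) := by
  have h := ENNReal.Tendsto.const_mul (a := ENNReal.ofReal (Real.exp t))
    (ENNReal.tendsto_pow_atTop_nhds_zero_of_lt_one hq1) (Or.inr ENNReal.ofReal_ne_top)
  rw [mul_zero] at h
  exact tendsto_of_tendsto_of_tendsto_of_le_of_le tendsto_const_nhds h (fun _ => zero_le)
    fun n => G.measure_jumpTime_le π₁ π₂ i hq t n

/-- The trajectories with exactly `n` jumps in `(0, t]`. -/
def jumpSet (t : ℝ) (n : ℕ) : Set (ℕ → G.Stage) :=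
  {ω | G.jumpTime n ω ≤ t ∧ t < G.jumpTime (n + 1) ω}

theorem measurableSet_jumpSet (t : ℝ) (n : ℕ) : MeasurableSet (G.jumpSet t n) :=
  (measurableSet_Iic.preimage (G.measurable_jumpTime n)).inter
    (measurableSet_Ioi.preimage (G.measurable_jumpTime (n + 1)))

theorem isGreatest_of_mem_jumpSet {t : ℝ} {n : ℕ} {ω : ℕ → G.Stage} (h : ω ∈ G.jumpSet t n) :
    IsGreatest {m | G.jumpTime m ω ≤ t} n := by
  refine ⟨h.1, fun m hm => ?_⟩
  by_contra! hlt
  exact (h.2.trans_le ((G.strictMono_jumpTime ω).monotone (Nat.succ_le_of_lt hlt))).not_ge hm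

theorem numJumps_eq {t : ℝ} {n : ℕ} {ω : ℕ → G.Stage} (h : ω ∈ G.jumpSet t n) :
    G.numJumps t ω = n :=
  (G.isGreatest_of_mem_jumpSet h).csSup_eq

theorem pairwise_disjoint_jumpSet (t : ℝ) : Pairwise (Function.onFun Disjoint (G.jumpSet t)) := by
  intro m n hmn
  refine Set.disjoint_left.2 fun ω hm hn => hmn ?_
  rw [← G.numJumps_eq hm, G.numJumps_eq hn]

/-- A trajectory outside all these sets has every jump before $t$, an event of probability $0$ since
$\mathbb P(T_n\le t)\to0$. On the rest $N_t$ is an actual maximum, so the default value of `sSup`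
plays no role. -/
theorem ae_mem_iUnion_jumpSet {q : ℝ≥0∞} (hq1 : q < 1)
    (hq : ∀ k, ∫⁻ s, ENNReal.ofReal (Real.exp (-(s : ℝ))) ∂G.sojourn k ≤ q) {t : ℝ} (ht : 0 ≤ t) :
    ∀ᵐ ω ∂G.law π₁ π₂ i, ω ∈ ⋃ n, G.jumpSet t n := by
  have h0 : G.law π₁ π₂ i (⋂ n, {ω | G.jumpTime n ω ≤ t}) = 0 :=
    le_antisymm (ge_of_tendsto' (G.tendsto_measure_jumpTime_le π₁ π₂ i hq1 hq t)
      fun n => measure_mono (iInter_subset _ n)) zero_le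
  rw [ae_iff]
  refine measure_mono_null (fun ω hω => ?_) h0
  refine mem_iInter.2 fun n => ?_
  induction n with
  | zero => simpa [jumpTime] using ht
  | succ n ih =>
    by_contra hlt
    exact hω (mem_iUnion.2 ⟨n, ih, not_le.1 hlt⟩)

theorem lintegral_eq_tsum_jumpSet {q : ℝ≥0∞} (hq1 : q < 1)
    (hq : ∀ k, ∫⁻ s, ENNReal.ofReal (Real.exp (-(s : ℝ))) ∂G.sojourn k ≤ q) {t : ℝ} (ht : 0 ≤ t)
    (f : (ℕ → G.Stage) → ℝ≥0∞) : ∫⁻ ω, f ω ∂G.law π₁ π₂ i =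
      ∑' n, ∫⁻ ω in G.jumpSet t n, f ω ∂G.law π₁ π₂ i := by
  rw [← setLIntegral_univ, ← setLIntegral_congr (s := ⋃ n, G.jumpSet t n)
    (eventuallyEq_univ.2 (G.ae_mem_iUnion_jumpSet π₁ π₂ i hq1 hq ht)),
    lintegral_iUnion (G.measurableSet_jumpSet t) (G.pairwise_disjoint_jumpSet t)]

/-- The factor `exp (θ (∫_0^s ρ(k,t) dt - g s))` of a stage. -/
def stageWeight (ρ : G.K → ℝ → ℝ) (θ g : ℝ) (x : G.Stage) : ℝ≥0∞ :=
  ENNReal.ofReal (Real.exp (θ * ((∫ t in (0 : ℝ)..(x.2 : ℝ), ρ x.1 t) - g * (x.2 : ℝ))))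

theorem prod_stageWeight (ρ : G.K → ℝ → ℝ) (θ g : ℝ) (n : ℕ) (ω : ℕ → G.Stage) :
    ∏ k ∈ Finset.range n, G.stageWeight ρ θ g (ω k) = ENNReal.ofReal (Real.exp (θ *
      ((∑ k ∈ Finset.range n, ∫ t in (0 : ℝ)..((ω k).2 : ℝ), ρ (ω k).1 t) -
        g * G.jumpTime n ω))) := by
  simp only [stageWeight]
  rw [← ENNReal.ofReal_prod_of_nonneg fun _ _ => (Real.exp_pos _).le, ← Real.exp_sum, jumpTime,
    ← Finset.mul_sum, Finset.sum_sub_distrib, Finset.mul_sum]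

variable {G} {ρ : G.K → ℝ → ℝ} {θ g c β : ℝ}

theorem abs_intervalIntegral_le (hb : ∀ k s, |ρ k s| ≤ c) (k : G.K) {a b : ℝ} (hab : a ≤ b) :
    |∫ t in a..b, ρ k t| ≤ c * (b - a) := by
  have h := intervalIntegral.norm_integral_le_of_norm_le_const (a := a) (b := b) (f := ρ k)
    (C := c) (fun x _ => hb k x)
  rwa [Real.norm_eq_abs, abs_of_nonneg (sub_nonneg.2 hab)] at h

/-- Both the accumulated cost and $-gT_n$ are at most $cT_n\le ct$. This bounds the remainder in the
stopping argument at time $t$. -/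
theorem prod_stageWeight_le (hθ : 0 < θ) (hb : ∀ k s, |ρ k s| ≤ c) (hg : |g| ≤ c) {t : ℝ} {n : ℕ}
    {ω : ℕ → G.Stage} (h : G.jumpTime n ω ≤ t) :
    ∏ k ∈ Finset.range n, G.stageWeight ρ θ g (ω k) ≤
      ENNReal.ofReal (Real.exp (θ * (2 * c * t))) := by
  rw [prod_stageWeight]
  refine ENNReal.ofReal_le_ofReal (Real.exp_le_exp.2 (mul_le_mul_of_nonneg_left ?_ hθ.le))
  have hc : 0 ≤ c := (abs_nonneg g).trans hg
  have h1 : ∑ k ∈ Finset.range n, ∫ t in (0 : ℝ)..((ω k).2 : ℝ), ρ (ω k).1 t ≤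
      c * G.jumpTime n ω := by
    rw [jumpTime, Finset.mul_sum]
    refine Finset.sum_le_sum fun k _ => ?_
    have := abs_intervalIntegral_le hb (ω k).1 (ω k).2.2.le
    rw [sub_zero] at this
    exact (le_abs_self _).trans this
  have h0 : 0 ≤ G.jumpTime n ω := Finset.sum_nonneg fun k _ => (ω k).2.2.le
  have h2 : -(g * G.jumpTime n ω) ≤ c * G.jumpTime n ω := by
    have := mul_le_mul_of_nonneg_right ((neg_le_abs g).trans hg) h0
    linarith
  nlinarith

/-- Between `t` and the next jump the exponent changes by at most `2 c β`. -/
theorem abs_totalCost_sub_le (hρ : ∀ k, Continuous (ρ k)) (hb : ∀ k s, |ρ k s| ≤ c) (hg : |g| ≤ c)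
    {t : ℝ} {n : ℕ} {ω : ℕ → G.Stage} (h : ω ∈ G.jumpSet t n) (hβ : ((ω n).2 : ℝ) ≤ β) :
    |((∑ k ∈ Finset.range (n + 1), ∫ t in (0 : ℝ)..((ω k).2 : ℝ), ρ (ω k).1 t) -
        g * G.jumpTime (n + 1) ω) - (G.totalCost ρ t ω - g * t)| ≤ 2 * c * β := by
  have hT : G.jumpTime (n + 1) ω = G.jumpTime n ω + ((ω n).2 : ℝ) := G.jumpTime_succ n ω
  have h1 := h.1
  have h2 := h.2
  have hc : 0 ≤ c := (abs_nonneg g).trans hg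
  rw [totalCost, G.numJumps_eq h, Finset.sum_range_succ]
  set r := t - G.jumpTime n ω with hr
  have hsplit : (∫ x in (0 : ℝ)..((ω n).2 : ℝ), ρ (ω n).1 x) =
      (∫ x in (0 : ℝ)..r, ρ (ω n).1 x) + ∫ x in r..((ω n).2 : ℝ), ρ (ω n).1 x :=
    (intervalIntegral.integral_add_adjacent_intervals ((hρ _).intervalIntegrable _ _)
      ((hρ _).intervalIntegrable _ _)).symm
  have hrs : r ≤ ((ω n).2 : ℝ) := by linarith
  have hI := abs_intervalIntegral_le hb (ω n).1 hrs
  rw [hsplit, hT]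
  -- What remains is the cost and the $g$-compensation over the time from $t$ to the next jump, each
  -- at most $c\beta$ in absolute value.
  have e : ∀ a b d : ℝ, a + (b + d) - g * (G.jumpTime n ω + ((ω n).2 : ℝ)) - (a + b - g * t) =
      d - g * (((ω n).2 : ℝ) - r) := fun a b d => by rw [hr]; ring
  rw [e]
  have h3 : |g * (((ω n).2 : ℝ) - r)| ≤ c * (((ω n).2 : ℝ) - r) := by
    rw [abs_mul, abs_of_nonneg (sub_nonneg.2 hrs)]
    exact mul_le_mul_of_nonneg_right hg (sub_nonneg.2 hrs)
  have h4 : ((ω n).2 : ℝ) - r ≤ β := by linarith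
  have h5 := mul_le_mul_of_nonneg_left h4 hc
  calc _ ≤ _ := abs_sub _ _
    _ ≤ 2 * c * β := by linarith

theorem exp_totalCost_le (hθ : 0 < θ) (hρ : ∀ k, Continuous (ρ k)) (hb : ∀ k s, |ρ k s| ≤ c)
    (hg : |g| ≤ c) {t : ℝ} {n : ℕ} {ω : ℕ → G.Stage} (h : ω ∈ G.jumpSet t n)
    (hβ : ((ω n).2 : ℝ) ≤ β) :
    ENNReal.ofReal (Real.exp (θ * G.totalCost ρ t ω)) ≤
      ENNReal.ofReal (Real.exp (θ * (2 * c * β) + θ * g * t)) *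
        ∏ k ∈ Finset.range (n + 1), G.stageWeight ρ θ g (ω k) := by
  rw [prod_stageWeight, ← ENNReal.ofReal_mul (Real.exp_pos _).le, ← Real.exp_add]
  refine ENNReal.ofReal_le_ofReal (Real.exp_le_exp.2 ?_)
  have := (abs_le.1 (abs_totalCost_sub_le hρ hb hg h hβ)).1
  nlinarith

theorem prod_stageWeight_le_exp_totalCost (hθ : 0 < θ) (hρ : ∀ k, Continuous (ρ k))
    (hb : ∀ k s, |ρ k s| ≤ c) (hg : |g| ≤ c) {t : ℝ} {n : ℕ} {ω : ℕ → G.Stage}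
    (h : ω ∈ G.jumpSet t n) (hβ : ((ω n).2 : ℝ) ≤ β) :
    ∏ k ∈ Finset.range (n + 1), G.stageWeight ρ θ g (ω k) ≤
      ENNReal.ofReal (Real.exp (θ * (2 * c * β) + -(θ * g * t))) *
        ENNReal.ofReal (Real.exp (θ * G.totalCost ρ t ω)) := by
  rw [prod_stageWeight, ← ENNReal.ofReal_mul (Real.exp_pos _).le, ← Real.exp_add]
  refine ENNReal.ofReal_le_ofReal (Real.exp_le_exp.2 ?_)
  have := (abs_le.1 (abs_totalCost_sub_le hρ hb hg h hβ)).2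
  nlinarith

/-! ### Stopping at the first jump after time $t$ -/

variable (G) in
/-- The histories whose last jump time is at most `t`. -/
def histBefore (t : ℝ) (n : ℕ) : Set (G.Hist n) := {h | ∑ k, ((h.1 k).2 : ℝ) ≤ t}

theorem measurableSet_histBefore (t : ℝ) (n : ℕ) : MeasurableSet (G.histBefore t n) := by
  refine measurableSet_Iic.preimage (f := fun h : G.Hist n => ∑ k, ((h.1 k).2 : ℝ))
    (Finset.measurable_sum _ fun k _ => ?_)
  exact measurable_subtype_coe.comp
    (measurable_snd.comp ((measurable_pi_apply k).comp measurable_fst))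

theorem hist_mem_histBefore {t : ℝ} {n : ℕ} {ω : ℕ → G.Stage} :
    G.hist n ω ∈ G.histBefore t n ↔ G.jumpTime n ω ≤ t := by
  rw [jumpTime, Finset.sum_range]
  rfl

/-- The stopping index is $N_t+1$: whether stage $n$ is run is decided by $T_n\le t$, which the
history at jump $n$ determines. Afterwards either $T_{n+1}$ exceeds $t$ and the process stops, or it
continues. -/
theorem lintegral_histBefore_succ (hw : Measurable (G.stageWeight ρ θ g)) {t : ℝ}
    (u : S → ℝ≥0∞) (n : ℕ) :
    ∫⁻ ω, (∏ k ∈ Finset.range (n + 1), G.stageWeight ρ θ g (ω k)) *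
        (G.histBefore t n).indicator 1 (G.hist n ω) * u (G.state (n + 1) ω) ∂G.law π₁ π₂ i =
      ∫⁻ ω in G.jumpSet t n, (∏ k ∈ Finset.range (n + 1), G.stageWeight ρ θ g (ω k)) *
          u (G.state (n + 1) ω) ∂G.law π₁ π₂ i +
        ∫⁻ ω, (∏ k ∈ Finset.range (n + 1), G.stageWeight ρ θ g (ω k)) *
          (G.histBefore t (n + 1)).indicator 1 (G.hist (n + 1) ω) *
          u (G.state (n + 1) ω) ∂G.law π₁ π₂ i := by
  rw [← lintegral_indicator (G.measurableSet_jumpSet t n), ← lintegral_add_left]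
  · refine lintegral_congr fun ω => ?_
    have hlt := (G.strictMono_jumpTime ω) n.lt_succ_self
    by_cases h1 : G.jumpTime n ω ≤ t
    · rw [indicator_of_mem (hist_mem_histBefore.2 h1)]
      by_cases h2 : G.jumpTime (n + 1) ω ≤ t
      · rw [indicator_of_mem (hist_mem_histBefore.2 h2),
          indicator_of_notMem fun h : ω ∈ G.jumpSet t n => h.2.not_ge h2]
        simp
      · rw [indicator_of_notMem fun h => h2 (hist_mem_histBefore.1 h),
          indicator_of_mem (show ω ∈ G.jumpSet t n from ⟨h1, not_le.1 h2⟩)]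
        simp
    · rw [indicator_of_notMem fun h => h1 (hist_mem_histBefore.1 h),
        indicator_of_notMem fun h => h1 (hlt.le.trans (hist_mem_histBefore.1 h)),
        indicator_of_notMem fun h : ω ∈ G.jumpSet t n => h1 h.1]
      simp
  · refine Measurable.indicator ?_ (G.measurableSet_jumpSet t n)
    exact (Finset.measurable_prod _ fun k _ => hw.comp (measurable_pi_apply k)).mul
      ((measurable_of_finite u).comp (G.measurable_state (n + 1)))

variable {u : S → ℝ≥0∞} {γ : G.K → ℝ≥0∞} {q : ℝ≥0∞}

theorem lintegral_histBefore_zero {t : ℝ} (ht : 0 ≤ t) :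
    ∫⁻ ω, (∏ k ∈ Finset.range 0, G.stageWeight ρ θ g (ω k)) *
      (G.histBefore t 0).indicator 1 (G.hist 0 ω) * u (G.state 0 ω) ∂G.law π₁ π₂ i = u i := by
  rw [← G.lintegral_law_state_zero π₁ π₂ i u]
  refine lintegral_congr fun ω => ?_
  rw [indicator_of_mem (hist_mem_histBefore.2 (by simpa [jumpTime] using ht))]
  simp

/-- The unstopped part at step $n$ is at most a constant depending on $t$ times $\mathbb P(T_n\le
t)$, which tends to $0$ by non-explosion. -/
theorem le_tsum_jumpSet (hθ : 0 < θ) (hb : ∀ k s, |ρ k s| ≤ c) (hg : |g| ≤ c) (hq1 : q < 1)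
    (hq : ∀ k, ∫⁻ s, ENNReal.ofReal (Real.exp (-(s : ℝ))) ∂G.sojourn k ≤ q)
    (hw : Measurable (G.stageWeight ρ θ g))
    (hγ : ∀ k, ∫⁻ s, G.stageWeight ρ θ g (k, s) ∂G.sojourn k = γ k) (hu : ∀ j, u j ≠ ∞)
    (hle : ∀ n (h : G.Hist n), u h.2 ≤ G.stageOp γ u (G.actionKernel π₁ π₂ n h))
    {t : ℝ} (ht : 0 ≤ t) :
    u i ≤ ∑' n, ∫⁻ ω in G.jumpSet t n, (∏ k ∈ Finset.range (n + 1), G.stageWeight ρ θ g (ω k)) *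
      u (G.state (n + 1) ω) ∂G.law π₁ π₂ i := by
  rw [← lintegral_histBefore_zero (ρ := ρ) (θ := θ) (g := g) π₁ π₂ i (u := u) ht]
  refine ENNReal.le_tsum_of_le_add_of_tendsto_zero (a := fun n => ∫⁻ ω,
    (∏ k ∈ Finset.range n, G.stageWeight ρ θ g (ω k)) *
      (G.histBefore t n).indicator 1 (G.hist n ω) * u (G.state n ω) ∂G.law π₁ π₂ i)
    (fun n => ?_) ?_
  · rw [← lintegral_histBefore_succ π₁ π₂ i hw u n]
    exact G.lintegral_law_le_succ π₁ π₂ i n (measurableSet_histBefore t n) hw hγ (hle n)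
  · set C := ENNReal.ofReal (Real.exp (θ * (2 * c * t))) * ∑ j, u j with hC
    have hCt : C ≠ ∞ :=
      ENNReal.mul_ne_top ENNReal.ofReal_ne_top (ENNReal.sum_ne_top.2 fun j _ => hu j)
    have h1 := ENNReal.Tendsto.const_mul (a := C)
      (G.tendsto_measure_jumpTime_le π₁ π₂ i hq1 hq t) (Or.inr hCt)
    rw [mul_zero] at h1
    refine tendsto_of_tendsto_of_tendsto_of_le_of_le tendsto_const_nhds h1
      (fun _ => zero_le) fun n => ?_
    have hm : MeasurableSet {ω | G.jumpTime n ω ≤ t} :=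
      measurableSet_Iic.preimage (G.measurable_jumpTime n)
    simp only
    rw [← lintegral_indicator_one hm, ← lintegral_const_mul' _ _ hCt]
    refine lintegral_mono fun ω => ?_
    by_cases h : G.jumpTime n ω ≤ t
    · rw [indicator_of_mem (hist_mem_histBefore.2 h),
        indicator_of_mem (show ω ∈ {ω | G.jumpTime n ω ≤ t} from h)]
      simp only [Pi.one_apply, mul_one]
      exact mul_le_mul' (prod_stageWeight_le hθ hb hg h)
        (Finset.single_le_sum (f := u) (fun _ _ => zero_le) (Finset.mem_univ _))
    · rw [indicator_of_notMem fun h' => h (hist_mem_histBefore.1 h')]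
      simp

theorem tsum_jumpSet_le (hw : Measurable (G.stageWeight ρ θ g))
    (hγ : ∀ k, ∫⁻ s, G.stageWeight ρ θ g (k, s) ∂G.sojourn k = γ k)
    (hle : ∀ n (h : G.Hist n), G.stageOp γ u (G.actionKernel π₁ π₂ n h) ≤ u h.2)
    {t : ℝ} (ht : 0 ≤ t) :
    ∑' n, ∫⁻ ω in G.jumpSet t n, (∏ k ∈ Finset.range (n + 1), G.stageWeight ρ θ g (ω k)) *
      u (G.state (n + 1) ω) ∂G.law π₁ π₂ i ≤ u i := by
  rw [← lintegral_histBefore_zero (ρ := ρ) (θ := θ) (g := g) π₁ π₂ i (u := u) ht]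
  refine ENNReal.tsum_le_of_add_le (a := fun n => ∫⁻ ω,
    (∏ k ∈ Finset.range n, G.stageWeight ρ θ g (ω k)) *
      (G.histBefore t n).indicator 1 (G.hist n ω) * u (G.state n ω) ∂G.law π₁ π₂ i) fun n => ?_
  rw [← lintegral_histBefore_succ π₁ π₂ i hw u n]
  exact G.lintegral_law_succ_le π₁ π₂ i n (measurableSet_histBefore t n) hw hγ (hle n)

/-- At the stopping index, `u` is bounded above and the stage weights differ from
$e^{\theta(\mathcal C_t-gt)}$ by at most the factor $e^{2\theta c\beta}$. Hence $\mathbb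
E[e^{\theta\mathcal C_t}]$ is at least a constant times $e^{\theta gt}$. The policies may depend on
the history, since only the conditional law of each stage is used. -/
theorem le_avgCost (hθ : 0 < θ) (hρ : ∀ k, Continuous (ρ k)) (hb : ∀ k s, |ρ k s| ≤ c)
    (hg : |g| ≤ c) (hβ : ∀ k, G.sojourn k {s | (s : ℝ) ≤ β} = 1) (hq1 : q < 1)
    (hq : ∀ k, ∫⁻ s, ENNReal.ofReal (Real.exp (-(s : ℝ))) ∂G.sojourn k ≤ q)
    (hw : Measurable (G.stageWeight ρ θ g))
    (hγ : ∀ k, ∫⁻ s, G.stageWeight ρ θ g (k, s) ∂G.sojourn k = γ k) (hu0 : ∀ j, u j ≠ 0)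
    (hu : ∀ j, u j ≠ ∞)
    (hle : ∀ n (h : G.Hist n), u h.2 ≤ G.stageOp γ u (G.actionKernel π₁ π₂ n h)) :
    g ≤ G.avgCost ρ θ i π₁ π₂ := by
  set U := ∑ j, u j with hU
  have hUt : U ≠ ∞ := ENNReal.sum_ne_top.2 fun j _ => hu j
  have hU' : ∀ j, u j ≤ U := fun j =>
    Finset.single_le_sum (f := u) (fun _ _ => zero_le) (Finset.mem_univ j)
  have hU0 : U ≠ 0 := fun h => hu0 i (le_antisymm (h ▸ hU' i) zero_le)
  set e := ENNReal.ofReal (Real.exp (θ * (2 * c * β))) with he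
  have he0 : e ≠ 0 := (ENNReal.ofReal_pos.2 (Real.exp_pos _)).ne'
  refine le_limsup_growth (C := u i / (U * e)) hθ
    (ENNReal.div_ne_zero.2 ⟨hu0 i, ENNReal.mul_ne_top hUt ENNReal.ofReal_ne_top⟩)
    (ENNReal.div_ne_top (hu i) (mul_ne_zero hU0 he0)) fun t ht => ?_
  have hae := G.ae_sojourn_le π₁ π₂ i hβ
  have key : u i ≤ U * (e * ENNReal.ofReal (Real.exp (-(θ * g * t)))) *
      ∫⁻ ω, ENNReal.ofReal (Real.exp (θ * G.totalCost ρ t ω)) ∂G.law π₁ π₂ i := by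
    refine (le_tsum_jumpSet π₁ π₂ i hθ hb hg hq1 hq hw hγ hu hle ht.le).trans ?_
    rw [G.lintegral_eq_tsum_jumpSet π₁ π₂ i hq1 hq ht.le, ← ENNReal.tsum_mul_left]
    refine ENNReal.tsum_le_tsum fun n => ?_
    rw [← lintegral_const_mul' _ _ (ENNReal.mul_ne_top hUt
      (ENNReal.mul_ne_top ENNReal.ofReal_ne_top ENNReal.ofReal_ne_top))]
    refine setLIntegral_mono_ae' (G.measurableSet_jumpSet t n) ?_
    filter_upwards [hae] with ω hω hn
    rw [mul_assoc, mul_comm]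
    refine mul_le_mul' (hU' _) ?_
    rw [← ENNReal.ofReal_mul (Real.exp_pos _).le, ← Real.exp_add]
    exact prod_stageWeight_le_exp_totalCost hθ hρ hb hg hn (hω n)
  have hcancel : ENNReal.ofReal (Real.exp (-(θ * g * t))) *
      ENNReal.ofReal (Real.exp (θ * g * t)) = 1 := by
    rw [← ENNReal.ofReal_mul (Real.exp_pos _).le, ← Real.exp_add]
    simp
  rw [← ENNReal.mul_div_right_comm]
  refine ENNReal.div_le_of_le_mul' ((mul_le_mul' key le_rfl).trans (le_of_eq ?_))
  rw [← mul_one (U * e), ← hcancel]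
  ring

theorem avgCost_le (hθ : 0 < θ) (hρ : ∀ k, Continuous (ρ k)) (hb : ∀ k s, |ρ k s| ≤ c)
    (hg : |g| ≤ c) (hβ : ∀ k, G.sojourn k {s | (s : ℝ) ≤ β} = 1) (hq1 : q < 1)
    (hq : ∀ k, ∫⁻ s, ENNReal.ofReal (Real.exp (-(s : ℝ))) ∂G.sojourn k ≤ q)
    (hw : Measurable (G.stageWeight ρ θ g))
    (hγ : ∀ k, ∫⁻ s, G.stageWeight ρ θ g (k, s) ∂G.sojourn k = γ k) (hu0 : ∀ j, u j ≠ 0)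
    (hu : ∀ j, u j ≠ ∞)
    (hle : ∀ n (h : G.Hist n), G.stageOp γ u (G.actionKernel π₁ π₂ n h) ≤ u h.2) :
    G.avgCost ρ θ i π₁ π₂ ≤ g := by
  -- A lower bound on `u` is needed here: $V$ dominates every $1/u_j$, so $1\le V u_j$ at whatever
  -- state the process stops.
  set V := ∑ j, (u j)⁻¹ with hV
  have hVt : V ≠ ∞ := ENNReal.sum_ne_top.2 fun j _ => ENNReal.inv_ne_top.2 (hu0 j)
  have hV' : ∀ j, (u j)⁻¹ ≤ V := fun j =>
    Finset.single_le_sum (f := fun j => (u j)⁻¹) (fun _ _ => zero_le) (Finset.mem_univ j)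
  have hV1 : ∀ j, 1 ≤ V * u j := fun j => by
    rw [← ENNReal.inv_mul_cancel (hu0 j) (hu j)]
    exact mul_le_mul' (hV' j) le_rfl
  have hV0 : V ≠ 0 := fun h => by
    have := hV1 i
    rw [h, zero_mul] at this
    exact absurd this (by simp)
  set e := ENNReal.ofReal (Real.exp (θ * (2 * c * β))) with he
  have he0 : e ≠ 0 := (ENNReal.ofReal_pos.2 (Real.exp_pos _)).ne'
  refine limsup_growth_le (C := V * e * u i) hθ (mul_ne_zero (mul_ne_zero hV0 he0) (hu0 i))
    (ENNReal.mul_ne_top (ENNReal.mul_ne_top hVt ENNReal.ofReal_ne_top) (hu i)) fun t ht => ?_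
  have hae := G.ae_sojourn_le π₁ π₂ i hβ
  have h1 := tsum_jumpSet_le π₁ π₂ i hw hγ hle ht.le
  rw [mul_right_comm]
  refine le_trans ?_ (mul_le_mul' le_rfl h1)
  rw [G.lintegral_eq_tsum_jumpSet π₁ π₂ i hq1 hq ht.le, ← ENNReal.tsum_mul_left]
  refine ENNReal.tsum_le_tsum fun n => ?_
  rw [← lintegral_const_mul' _ _ (ENNReal.mul_ne_top
    (ENNReal.mul_ne_top hVt ENNReal.ofReal_ne_top) ENNReal.ofReal_ne_top)]
  refine setLIntegral_mono_ae' (G.measurableSet_jumpSet t n) ?_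
  filter_upwards [hae] with ω hω hn
  refine (exp_totalCost_le hθ hρ hb hg hn (hω n)).trans ?_
  rw [Real.exp_add, ENNReal.ofReal_mul (Real.exp_pos _).le, ← he]
  set P := ∏ k ∈ Finset.range (n + 1), G.stageWeight ρ θ g (ω k)
  set x := ENNReal.ofReal (Real.exp (θ * g * t))
  calc e * x * P = 1 * (e * x * P) := (one_mul _).symm
    _ ≤ V * u (G.state (n + 1) ω) * (e * x * P) := mul_le_mul' (hV1 _) le_rfl
    _ = _ := by ring

end SemiMarkovGame

/-! ### Consequences of compactness and continuity -/

namespace SemiMarkovGame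

variable {S A B : Type*} [Fintype S] [TopologicalSpace S] [DiscreteTopology S]
  [MeasurableSpace S] [DiscreteMeasurableSpace S]
  [TopologicalSpace A] [TopologicalSpace.MetrizableSpace A] [SecondCountableTopology A]
  [MeasurableSpace A] [BorelSpace A]
  [TopologicalSpace B] [TopologicalSpace.MetrizableSpace B] [SecondCountableTopology B]
  [MeasurableSpace B] [BorelSpace B]
  {G : SemiMarkovGame S A B} {β : ℝ}

/-- The cost rate `ρ(k, ·)` frozen outside `[0, β]`. -/
def clampCost (β : ℝ) (ρ : G.K → ℝ → ℝ) (k : G.K) (s : ℝ) : ℝ := ρ k (max 0 (min s β))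

theorem clamp_mem_Icc (hβ : 0 ≤ β) (s : ℝ) : max 0 (min s β) ∈ Icc 0 β :=
  ⟨le_max_left _ _, max_le hβ (min_le_right _ _)⟩

theorem clamp_eq {s : ℝ} (hs : s ∈ Icc 0 β) : max 0 (min s β) = s := by
  rw [min_eq_left hs.2, max_eq_right hs.1]

theorem clampCost_eq (ρ : G.K → ℝ → ℝ) (k : G.K) {s : ℝ} (hs : s ∈ Icc 0 β) :
    clampCost β ρ k s = ρ k s := by
  rw [clampCost, clamp_eq hs]

theorem integral_clampCost (ρ : G.K → ℝ → ℝ) (k : G.K) {s : ℝ} (hs : s ∈ Icc 0 β) :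
    ∫ t in (0 : ℝ)..s, clampCost β ρ k t = ∫ t in (0 : ℝ)..s, ρ k t := by
  refine intervalIntegral.integral_congr fun t ht => ?_
  rw [uIcc_of_le hs.1] at ht
  exact clampCost_eq ρ k ⟨ht.1, ht.2.trans hs.2⟩

theorem continuous_clampCost (hβ : 0 ≤ β) {ρ : G.K → ℝ → ℝ}
    (hρ : ContinuousOn (fun x : G.K × ℝ => ρ x.1 x.2) (univ ×ˢ Icc 0 β)) :
    Continuous (Function.uncurry (clampCost β ρ)) :=
  hρ.comp_continuous (f := fun x : G.K × ℝ => (x.1, max 0 (min x.2 β))) (by fun_prop)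
    fun x => ⟨mem_univ _, clamp_mem_Icc hβ x.2⟩

namespace Regular

variable (H : G.Regular β)

include H

theorem compactSpace_K : CompactSpace G.K := by
  refine isCompact_iff_compactSpace.1 ?_
  have h : admissibleSet G.act₁ G.act₂ = ⋃ i : S, {i} ×ˢ (G.act₁ i ×ˢ G.act₂ i) := by
    ext ⟨i, a, b⟩
    simp [admissibleSet]
  rw [h]
  exact isCompact_iUnion fun i =>
    isCompact_singleton.prod ((H.isCompact_act₁ i).prod (H.isCompact_act₂ i))

theorem abs_clampCost_le {ρ : G.K → ℝ → ℝ}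
    (hρ : ContinuousOn (fun x : G.K × ℝ => ρ x.1 x.2) (univ ×ˢ Icc 0 β)) (k : G.K) (s : ℝ) :
    |clampCost β ρ k s| ≤ G.costBound ρ β := by
  have := H.compactSpace_K
  have hc : Continuous fun x : G.K × Icc (0 : ℝ) β => |ρ x.1 x.2| := by
    refine (hρ.comp_continuous (f := fun x : G.K × Icc (0 : ℝ) β => (x.1, (x.2 : ℝ))) ?_ ?_).abs
    · fun_prop
    · exact fun x => ⟨mem_univ _, x.2.2⟩
  exact le_ciSup (isCompact_range hc).bddAbove (k, ⟨max 0 (min s β), clamp_mem_Icc H.pos.le s⟩)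

theorem ae_le (k : G.K) : ∀ᵐ s : Ioi (0 : ℝ) ∂G.sojourn k, (s : ℝ) ≤ β := by
  rw [ae_iff]
  exact (prob_compl_eq_zero_iff (measurableSet_Iic.preimage measurable_subtype_coe)).2
    (H.sojourn_le k)

theorem ae_mem_Icc (k : G.K) : ∀ᵐ s : Ioi (0 : ℝ) ∂G.sojourn k, (s : ℝ) ∈ Icc 0 β := by
  filter_upwards [H.ae_le k] with s hs using ⟨s.2.le, hs⟩

/-- Integrals of jointly continuous functions over the sojourn time are continuous. -/
theorem continuous_integral_sojourn {W : G.K → ℝ → ℝ} (hW : Continuous (Function.uncurry W)) :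
    Continuous fun k => ∫ s, W k s ∂G.sojourn k := by
  have hcl : Continuous fun s : Ioi (0 : ℝ) => max 0 (min (s : ℝ) β) := by fun_prop
  have hWk : ∀ k, Continuous fun s : Ioi (0 : ℝ) => W k (max 0 (min (s : ℝ) β)) := fun k =>
    hW.comp (continuous_const.prodMk hcl)
  have hbdd : ∀ k, ∃ M, ∀ s : Ioi (0 : ℝ), |W k (max 0 (min (s : ℝ) β))| ≤ M := fun k => by
    obtain ⟨M, hM⟩ := (isCompact_Icc (a := (0 : ℝ)) (b := β)).exists_bound_of_continuousOn
      (f := W k) (hW.comp (continuous_const.prodMk continuous_id)).continuousOn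
    exact ⟨M, fun s => hM _ (clamp_mem_Icc H.pos.le s)⟩
  have hint : ∀ k k', Integrable (fun s : Ioi (0 : ℝ) => W k (max 0 (min (s : ℝ) β)))
      (G.sojourn k') := fun k k' => by
    obtain ⟨M, hM⟩ := hbdd k
    exact Integrable.of_bound (hWk k).measurable.aestronglyMeasurable M (Eventually.of_forall hM)
  have heq : (fun k => ∫ s, W k s ∂G.sojourn k) =
      fun k => ∫ s : Ioi (0 : ℝ), W k (max 0 (min (s : ℝ) β)) ∂G.sojourn k := by
    ext k
    refine integral_congr_ae ?_
    filter_upwards [H.ae_mem_Icc k] with s hs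
    rw [clamp_eq hs]
  rw [heq, continuous_iff_continuousAt]
  intro k₀
  have h1 := (H.continuous_sojourn _ (hWk k₀).measurable (hbdd k₀)).tendsto k₀
  rw [ContinuousAt, Metric.tendsto_nhds]
  intro ε hε
  -- Integrand and measure both vary with $k$. Compactness of $[0,\beta]$ makes $W(k,\cdot)$
  -- uniformly close to $W(k_0,\cdot)$; the assumed continuity of the sojourn law then handles the
  -- fixed integrand $W(k_0,\cdot)$.
  obtain ⟨v, hv, hv'⟩ := (isCompact_Icc (a := (0 : ℝ)) (b := β)).mem_uniformity_of_prod
    (f := W) (s := univ) (q := k₀) hW.continuousOn (mem_univ _)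
    (Metric.dist_mem_uniformity (half_pos hε))
  rw [nhdsWithin_univ] at hv
  filter_upwards [hv, Metric.tendsto_nhds.1 h1 (ε / 2) (half_pos hε)] with k hk hk2
  refine (dist_triangle _ (∫ s : Ioi (0 : ℝ), W k₀ (max 0 (min (s : ℝ) β)) ∂G.sojourn k) _).trans_lt
    ?_
  have h3 : dist (∫ s : Ioi (0 : ℝ), W k (max 0 (min (s : ℝ) β)) ∂G.sojourn k)
      (∫ s : Ioi (0 : ℝ), W k₀ (max 0 (min (s : ℝ) β)) ∂G.sojourn k) ≤ ε / 2 := by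
    rw [dist_eq_norm, ← integral_sub (hint _ _) (hint _ _)]
    refine (norm_integral_le_of_norm_le_const (C := ε / 2) (Eventually.of_forall fun s => ?_)).trans
      (by simp)
    exact (hv' k hk _ (clamp_mem_Icc H.pos.le s)).le
  linarith

/-- The mean of $e^{-s}$ is below $1$ for each $k$ because sojourn times are positive, and it
attains its maximum on the compact $\mathbb K$. -/
theorem exists_lintegral_exp_neg_le :
    ∃ q < 1, ∀ k, ∫⁻ s, ENNReal.ofReal (Real.exp (-(s : ℝ))) ∂G.sojourn k ≤ q := by
  have := H.compactSpace_K
  rcases isEmpty_or_nonempty G.K with he | hne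
  · exact ⟨0, one_pos, fun k => (he.false k).elim⟩
  have hint : ∀ k, Integrable (fun s : Ioi (0 : ℝ) => Real.exp (-(s : ℝ))) (G.sojourn k) :=
    fun k => Integrable.of_bound (by fun_prop) 1 (Eventually.of_forall fun s => by
      rw [Real.norm_eq_abs, abs_of_pos (Real.exp_pos _), Real.exp_le_one_iff]
      exact neg_nonpos.2 s.2.le)
  have hcont : Continuous fun k => ∫ s, Real.exp (-(s : ℝ)) ∂G.sojourn k :=
    H.continuous_integral_sojourn (W := fun _ s => Real.exp (-s)) (by fun_prop)
  obtain ⟨k₀, -, hk₀⟩ := isCompact_univ.exists_isMaxOn univ_nonempty hcont.continuousOn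
  have hlt : ∫ s, Real.exp (-(s : ℝ)) ∂G.sojourn k₀ < 1 := by
    have hpos : ∀ s : Ioi (0 : ℝ), 0 < 1 - Real.exp (-(s : ℝ)) := fun s =>
      sub_pos.2 (Real.exp_lt_one_iff.2 (neg_neg_of_pos s.2))
    have h1 : 0 < ∫ s : Ioi (0 : ℝ), (1 - Real.exp (-(s : ℝ))) ∂G.sojourn k₀ := by
      rw [integral_pos_iff_support_of_nonneg (fun s => (hpos s).le)
        ((integrable_const 1).sub (hint k₀))]
      rw [show Function.support (fun s : Ioi (0 : ℝ) => 1 - Real.exp (-(s : ℝ))) = univ from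
        eq_univ_of_forall fun s => (hpos s).ne', measure_univ]
      exact one_pos
    rw [integral_sub (integrable_const 1) (hint k₀)] at h1
    simpa using h1
  refine ⟨ENNReal.ofReal (∫ s, Real.exp (-(s : ℝ)) ∂G.sojourn k₀),
    ENNReal.ofReal_lt_one.2 hlt, fun k => ?_⟩
  rw [← ofReal_integral_eq_lintegral_ofReal (hint k)
    (Eventually.of_forall fun s => (Real.exp_pos _).le)]
  exact ENNReal.ofReal_le_ofReal (hk₀ (mem_univ k))

theorem continuous_trans_singleton (j : S) : Continuous fun k => G.trans k {j} := by
  have h : (fun k => G.trans k {j}) = fun k => ENNReal.ofReal (G.p k j) := by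
    ext k
    rw [p, ofReal_measureReal]
  rw [h]
  exact ENNReal.continuous_ofReal.comp (H.continuous_p j)

end Regular

/-! ### Integrals over the law of the state and the actions -/

theorem actionKernel_apply (π₁ : G.Policy₁) (π₂ : G.Policy₂) (n : ℕ) (h : G.Hist n) :
    G.actionKernel π₁ π₂ n h = G.actionLaw h.2 (π₁.kernel n h) (π₂.kernel n h) := by
  rw [actionKernel, Kernel.comapRight_apply, Kernel.prod_apply, Kernel.prod_apply,
    Kernel.deterministic_apply]
  rfl

/-- The extension by `0` of a function on `𝕂`. -/
def extendZero (f : G.K → ℝ≥0∞) : S × A × B → ℝ≥0∞ :=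
  Function.extend Subtype.val f fun _ => 0

theorem extendZero_apply (f : G.K → ℝ≥0∞) (k : G.K) : extendZero f k.1 = f k :=
  Subtype.val_injective.extend_apply f _ k

theorem measurable_extendZero {f : G.K → ℝ≥0∞} (hf : Measurable f) : Measurable (extendZero f) :=
  (MeasurableEmbedding.subtype_coe G.measurableSet_admissibleSet).measurable_extend hf
    measurable_const

/-- Extension by $0$ allows iterated integration over all of $A$ and $B$ without tracking
admissibility. -/
theorem lintegral_actionLaw (i : S) (ψ : Measure A) (φ : Measure B) [IsProbabilityMeasure ψ]
    [IsProbabilityMeasure φ] {f : G.K → ℝ≥0∞} (hf : Measurable f) :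
    ∫⁻ k, f k ∂G.actionLaw i ψ φ = ∫⁻ a, ∫⁻ b, extendZero f (i, a, b) ∂φ ∂ψ := by
  have hm := measurable_extendZero hf
  have hmi : Measurable fun y => extendZero f (i, y) := hm.comp measurable_prodMk_left
  have he := MeasurableEmbedding.subtype_coe G.measurableSet_admissibleSet
  calc ∫⁻ k, f k ∂G.actionLaw i ψ φ = ∫⁻ k, extendZero f k.1 ∂G.actionLaw i ψ φ :=
        lintegral_congr fun k => (extendZero_apply f k).symm
    _ = ∫⁻ x in admissibleSet G.act₁ G.act₂, extendZero f x ∂(Measure.dirac i).prod (ψ.prod φ) := by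
        rw [actionLaw, ← he.lintegral_map, map_comap_subtype_coe G.measurableSet_admissibleSet]
    _ = ∫⁻ x, extendZero f x ∂(Measure.dirac i).prod (ψ.prod φ) := by
        rw [← lintegral_indicator G.measurableSet_admissibleSet]
        refine lintegral_congr fun x => indicator_apply_eq_self.2 fun hx => ?_
        exact Function.extend_apply' _ _ _ (by rintro ⟨k, rfl⟩; exact hx k.2)
    _ = _ := by
        rw [lintegral_prod _ hm.aemeasurable, lintegral_dirac' _ (hm.lintegral_prod_right'),
          lintegral_prod (fun y => extendZero f (i, y)) hmi.aemeasurable]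

theorem lintegral_actionLaw_symm (i : S) (ψ : Measure A) (φ : Measure B) [IsProbabilityMeasure ψ]
    [IsProbabilityMeasure φ] {f : G.K → ℝ≥0∞} (hf : Measurable f) :
    ∫⁻ k, f k ∂G.actionLaw i ψ φ = ∫⁻ b, ∫⁻ a, extendZero f (i, a, b) ∂ψ ∂φ := by
  rw [lintegral_actionLaw i ψ φ hf, lintegral_lintegral_swap]
  exact ((measurable_extendZero hf).comp measurable_prodMk_left).aemeasurable

theorem isProbabilityMeasure_actionLaw (i : S) (ψ : Measure A) (φ : Measure B)
    [IsProbabilityMeasure ψ] [IsProbabilityMeasure φ] (hψ : ψ (G.act₁ i) = 1)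
    (hφ : φ (G.act₂ i) = 1) : IsProbabilityMeasure (G.actionLaw i ψ φ) := by
  refine ⟨le_antisymm ?_ ?_⟩
  · rw [actionLaw, comap_subtype_coe_apply G.measurableSet_admissibleSet]
    exact prob_le_one
  · rw [actionLaw, comap_subtype_coe_apply G.measurableSet_admissibleSet]
    refine le_trans (le_of_eq ?_) (measure_mono (s := {i} ×ˢ (G.act₁ i ×ˢ G.act₂ i)) ?_)
    · rw [Measure.prod_prod, Measure.prod_prod, hψ, hφ]
      simp
    · rintro ⟨j, a, b⟩ ⟨hj, ha, hb⟩
      obtain rfl : j = i := hj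
      exact ⟨⟨(j, a, b), ha, hb⟩, mem_univ _, rfl⟩

theorem continuousOn_extendZero {f : G.K → ℝ≥0∞} (hf : Continuous f) :
    ContinuousOn (extendZero f) (admissibleSet G.act₁ G.act₂) := by
  rw [continuousOn_iff_continuous_domRestrict]
  convert hf using 1
  ext k
  exact extendZero_apply f k

theorem Regular.exists_extendZero_le (H : G.Regular β) {f : G.K → ℝ≥0∞} (hf : Continuous f)
    (hft : ∀ k, f k ≠ ∞) : ∃ C ≠ ∞, ∀ x, extendZero f x ≤ C := by
  have := H.compactSpace_K
  have h : ∃ C ≠ ∞, ∀ k, f k ≤ C := by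
    rcases isEmpty_or_nonempty G.K with he | hne
    · exact ⟨0, ENNReal.zero_ne_top, fun k => (he.false k).elim⟩
    · obtain ⟨k, -, hk⟩ := isCompact_univ.exists_isMaxOn univ_nonempty hf.continuousOn
      exact ⟨f k, hft k, fun k' => hk (mem_univ k')⟩
  obtain ⟨C, hC, hle⟩ := h
  refine ⟨C, hC, fun x => ?_⟩
  by_cases hx : x ∈ admissibleSet G.act₁ G.act₂
  · exact (extendZero_apply f ⟨x, hx⟩).le.trans (hle _)
  · rw [extendZero, Function.extend_apply' _ _ _ (by rintro ⟨k, rfl⟩; exact hx k.2)]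
    exact zero_le

/-- A section integral that depends continuously on a compact set of actions attains its minimum. -/
theorem exists_forall_lintegral_le {X Y : Type*} [TopologicalSpace X] [FirstCountableTopology X]
    [MeasurableSpace Y] {C : Set X} (hC : IsCompact C) (hne : C.Nonempty) {C' : Set Y}
    {φ : Measure Y} [IsProbabilityMeasure φ] (hC' : MeasurableSet C') (hφ : φ C' = 1)
    {f : X → Y → ℝ≥0∞} (hfm : ∀ x, Measurable (f x)) {M : ℝ≥0∞} (hM : M ≠ ∞) (hfM : ∀ x y, f x y ≤ M)
    (hf : ∀ y ∈ C', ContinuousOn (fun x => f x y) C) :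
    ∃ x ∈ C, ∀ x' ∈ C, ∫⁻ y, f x y ∂φ ≤ ∫⁻ y, f x' y ∂φ := by
  refine hC.exists_isMinOn (f := fun x => ∫⁻ y, f x y ∂φ) hne fun x hx => ?_
  -- The section integral is continuous on `C` by bounded convergence; continuity of the integrand
  -- is required only for $y$ in the full-measure set `C'`.
  refine tendsto_lintegral_filter_of_dominated_convergence (fun _ => M)
    (Eventually.of_forall hfm) (Eventually.of_forall fun x' => Eventually.of_forall (hfM x'))
    (by simpa using hM) ?_
  have hae : ∀ᵐ y ∂φ, y ∈ C' := (prob_compl_eq_zero_iff hC').2 hφ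
  filter_upwards [hae] with y hy using hf y hy x hx

end SemiMarkovGame

/-! ### The mean stage factor and the solution of a player's problem -/

namespace SemiMarkovGame

variable {S A B : Type*} [Fintype S] [TopologicalSpace S] [DiscreteTopology S]
  [MeasurableSpace S] [DiscreteMeasurableSpace S]
  [TopologicalSpace A] [TopologicalSpace.MetrizableSpace A] [SecondCountableTopology A]
  [MeasurableSpace A] [BorelSpace A]
  [TopologicalSpace B] [TopologicalSpace.MetrizableSpace B] [SecondCountableTopology B]
  [MeasurableSpace B] [BorelSpace B]
  {G : SemiMarkovGame S A B} {β θ c : ℝ} {σ : G.K → ℝ → ℝ}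

theorem continuous_exp_integral (hσ : Continuous (Function.uncurry σ)) (θ g : ℝ) :
    Continuous fun x : G.K × ℝ =>
      Real.exp (θ * ((∫ t in (0 : ℝ)..x.2, σ x.1 t) - g * x.2)) := by
  have h : Continuous fun x : G.K × ℝ => ∫ t in (0 : ℝ)..x.2, σ x.1 t :=
    intervalIntegral.continuous_parametric_intervalIntegral_of_continuous
      (f := fun (x : G.K × ℝ) t => σ x.1 t)
      (hσ.comp ((continuous_fst.comp continuous_fst).prodMk continuous_snd)) continuous_snd
  fun_prop

theorem measurable_stageWeight (hσ : Continuous (Function.uncurry σ)) (θ g : ℝ) :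
    Measurable (G.stageWeight σ θ g) := by
  refine ENNReal.measurable_ofReal.comp (Continuous.measurable ?_)
  exact (continuous_exp_integral hσ θ g).comp
    (continuous_fst.prodMk (continuous_subtype_val.comp continuous_snd))

/-- The mean of `stageWeight` over the sojourn time. -/
def stageGain (σ : G.K → ℝ → ℝ) (θ g : ℝ) (k : G.K) : ℝ≥0∞ :=
  ∫⁻ s, G.stageWeight σ θ g (k, s) ∂G.sojourn k

theorem exponent_bounds (hb : ∀ k s, |σ k s| ≤ c) (k : G.K) {s : ℝ} (hs : 0 ≤ s) :
    -(c * s) ≤ ∫ t in (0 : ℝ)..s, σ k t ∧ ∫ t in (0 : ℝ)..s, σ k t ≤ c * s := by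
  have h := abs_intervalIntegral_le hb k hs
  rw [sub_zero] at h
  exact abs_le.1 h

theorem stageGain_le_of_forall {C : ℝ≥0∞} {g : ℝ} {k : G.K}
    (h : ∀ᵐ s ∂G.sojourn k, G.stageWeight σ θ g (k, s) ≤ C) : stageGain σ θ g k ≤ C :=
  (lintegral_mono_ae h).trans (by simp)

namespace Regular

variable (H : G.Regular β)

include H

theorem stageGain_eq (hθ : 0 < θ) (hσ : Continuous (Function.uncurry σ))
    (hb : ∀ k s, |σ k s| ≤ c) (g : ℝ) (k : G.K) :
    stageGain σ θ g k = ENNReal.ofReal (G.expFactor σ θ g k) := by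
  rw [expFactor, ofReal_integral_eq_lintegral_ofReal _
    (Eventually.of_forall fun s => (Real.exp_pos _).le)]
  · rfl
  refine Integrable.of_bound (C := Real.exp (θ * ((c + |g|) * β))) (Continuous.measurable
    ((continuous_exp_integral hσ θ g).comp
      (continuous_const.prodMk continuous_subtype_val))).aestronglyMeasurable ?_
  filter_upwards [H.ae_mem_Icc k] with s hs
  rw [Real.norm_eq_abs, abs_of_pos (Real.exp_pos _), Real.exp_le_exp]
  refine mul_le_mul_of_nonneg_left ?_ hθ.le
  have h1 := (exponent_bounds hb k hs.1).2
  have h2 : -(g * (s : ℝ)) ≤ |g| * s := by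
    rw [← neg_mul]
    exact mul_le_mul_of_nonneg_right (neg_le_abs g) hs.1
  have hc : 0 ≤ c := (abs_nonneg _).trans (hb k 0)
  have h3 := mul_le_mul_of_nonneg_left hs.2 (add_nonneg hc (abs_nonneg g))
  linarith

theorem continuous_stageGain (hθ : 0 < θ) (hσ : Continuous (Function.uncurry σ))
    (hb : ∀ k s, |σ k s| ≤ c) (g : ℝ) : Continuous (stageGain σ θ g) := by
  rw [show stageGain σ θ g = fun k => ENNReal.ofReal (G.expFactor σ θ g k) from
    funext fun k => H.stageGain_eq hθ hσ hb g k]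
  exact ENNReal.continuous_ofReal.comp
    (H.continuous_integral_sojourn
      (W := fun k s => Real.exp (θ * ((∫ t in (0 : ℝ)..s, σ k t) - g * s)))
      (continuous_exp_integral hσ θ g))

/-- The running cost and $-g$ each contribute at most $cs\le c\beta$ to the exponent, which produces
the constant $2\theta\beta c$ of the return assumption. -/
theorem stageGain_le (hθ : 0 < θ) (hb : ∀ k s, |σ k s| ≤ c) {g : ℝ} (hg : g ∈ Icc (-c) c)
    (k : G.K) : stageGain σ θ g k ≤ ENNReal.ofReal (Real.exp (2 * θ * β * c)) := by
  refine stageGain_le_of_forall ?_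
  filter_upwards [H.ae_mem_Icc k] with s hs
  refine ENNReal.ofReal_le_ofReal (Real.exp_le_exp.2 ?_)
  have h1 := (exponent_bounds hb k hs.1).2
  have h2 := mul_le_mul_of_nonneg_right hg.1 hs.1
  have hc : 0 ≤ c := (abs_nonneg _).trans (hb k 0)
  have h3 := mul_le_mul_of_nonneg_left hs.2 hc
  rw [show 2 * θ * β * c = θ * (c * β + c * β) by ring]
  refine mul_le_mul_of_nonneg_left ?_ hθ.le
  linarith

theorem stageGain_le_one (hθ : 0 < θ) (hb : ∀ k s, |σ k s| ≤ c) (k : G.K) :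
    stageGain σ θ c k ≤ 1 := by
  refine stageGain_le_of_forall ?_
  filter_upwards [H.ae_mem_Icc k] with s hs
  rw [stageWeight, ENNReal.ofReal_le_one, Real.exp_le_one_iff]
  have h1 := (exponent_bounds hb k hs.1).2
  exact mul_nonpos_of_nonneg_of_nonpos hθ.le (sub_nonpos.2 h1)

theorem one_le_stageGain_neg (hθ : 0 < θ) (hb : ∀ k s, |σ k s| ≤ c) (k : G.K) :
    1 ≤ stageGain σ θ (-c) k := by
  calc (1 : ℝ≥0∞) = ∫⁻ _, 1 ∂G.sojourn k := by simp
    _ ≤ _ := lintegral_mono_ae ?_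
  filter_upwards [H.ae_mem_Icc k] with s hs
  rw [stageWeight, ENNReal.one_le_ofReal]
  refine Real.one_le_exp (mul_nonneg hθ.le ?_)
  have h1 := (exponent_bounds hb k hs.1).1
  simp only
  linarith

/-- Replacing $g$ by $g'$ adds $\theta(g-g')s$ to the exponent, and $0\le s\le\beta$. -/
theorem stageGain_le_exp_mul (hθ : 0 < θ) (g g' : ℝ) (k : G.K) :
    stageGain σ θ g' k ≤
      ENNReal.ofReal (Real.exp (θ * β * |g - g'|)) * stageGain σ θ g k := by
  rw [stageGain, stageGain, ← lintegral_const_mul' _ _ ENNReal.ofReal_ne_top]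
  refine lintegral_mono_ae ?_
  filter_upwards [H.ae_mem_Icc k] with s hs
  rw [stageWeight, stageWeight, ← ENNReal.ofReal_mul (Real.exp_pos _).le, ← Real.exp_add]
  refine ENNReal.ofReal_le_ofReal (Real.exp_le_exp.2 ?_)
  simp only
  rw [mul_assoc θ β, ← mul_add]
  refine mul_le_mul_of_nonneg_left ?_ hθ.le
  have h1 : (g - g') * s ≤ |g - g'| * β :=
    (mul_le_mul_of_nonneg_right (le_abs_self _) hs.1).trans
      (mul_le_mul_of_nonneg_left hs.2 (abs_nonneg _))
  linarith

/-- Multiplication on extended nonnegative reals is discontinuous only at $0\cdot\infty$; finiteness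
of both factors rules this out. -/
theorem continuous_mul_sum_trans {γ : G.K → ℝ≥0∞} (hγ : Continuous γ) (hγt : ∀ k, γ k ≠ ∞)
    {u : S → ℝ≥0∞} (hu : ∀ j, u j ≠ ∞) : Continuous fun k => γ k * ∑ j, G.trans k {j} * u j := by
  have hs : ∀ k, ∑ j, G.trans k {j} * u j ≠ ∞ := fun k =>
    ENNReal.sum_ne_top.2 fun j _ => ENNReal.mul_ne_top (measure_ne_top _ _) (hu j)
  have hsum : Continuous fun k => ∑ j, G.trans k {j} * u j :=
    continuous_finsetSum _ fun j _ =>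
      ENNReal.continuous_mul_const (hu j) |>.comp (H.continuous_trans_singleton j)
  refine continuous_iff_continuousAt.2 fun k => ?_
  exact ENNReal.Tendsto.mul (hγ.tendsto k) (Or.inr (hs k)) (hsum.tendsto k) (Or.inr (hγt k))

/-! ### Only the cost rates on `[0, β]` matter -/

theorem expFactor_clampCost (ρ : G.K → ℝ → ℝ) (θ g : ℝ) (k : G.K) :
    G.expFactor (clampCost β ρ) θ g k = G.expFactor ρ θ g k := by
  refine integral_congr_ae ?_
  filter_upwards [H.ae_mem_Icc k] with s hs
  rw [integral_clampCost ρ k hs]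

theorem avgCost_clampCost (ρ : G.K → ℝ → ℝ) (θ : ℝ) (i : S) (π₁ : G.Policy₁) (π₂ : G.Policy₂) :
    G.avgCost (clampCost β ρ) θ i π₁ π₂ = G.avgCost ρ θ i π₁ π₂ := by
  refine limsup_congr ?_
  filter_upwards [eventually_gt_atTop 0] with t ht
  congr 2
  obtain ⟨q, hq1, hq⟩ := H.exists_lintegral_exp_neg_le
  refine lintegral_congr_ae ?_
  filter_upwards [G.ae_sojourn_le π₁ π₂ i H.sojourn_le,
    G.ae_mem_iUnion_jumpSet π₁ π₂ i hq1 hq ht.le] with ω hω hmem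
  obtain ⟨n, hn⟩ := mem_iUnion.1 hmem
  have hT : G.jumpTime (n + 1) ω = G.jumpTime n ω + ((ω n).2 : ℝ) := G.jumpTime_succ n ω
  have h1 := hn.1
  have h2 := hn.2
  have h3 := hω n
  -- On this event the age $t-T_n$ lies in $[0,\beta]$, since $t<T_{n+1}$ and the sojourn is at most
  -- $\beta$; no integral leaves the interval where the two costs agree.
  rw [totalCost, totalCost, G.numJumps_eq hn,
    integral_clampCost ρ (ω n).1 (s := t - G.jumpTime n ω) ⟨by linarith, by linarith⟩,
    Finset.sum_congr rfl fun k _ => integral_clampCost ρ (ω k).1 ⟨(ω k).2.2.le, hω k⟩]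

end Regular

/-- A family of sets of laws on `𝕂`, one for each state, from which one player can choose when the
other one is stationary. -/
structure IsActionFamily (D : S → Set (Measure G.K)) : Prop where
  isProbabilityMeasure : ∀ i, ∀ μ ∈ D i, IsProbabilityMeasure μ
  exists_min : ∀ f : G.K → ℝ≥0∞, Continuous f → (∀ k, f k ≠ ∞) → ∀ i, ∃ μ ∈ D i, ∀ ν ∈ D i,
    ∫⁻ k, f k ∂μ ≤ ∫⁻ k, f k ∂ν
  exists_stat : ∀ d : S → Measure G.K, (∀ i, d i ∈ D i) → ∃ (φ₁ : G.Stat₁) (φ₂ : G.Stat₂),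
    ∀ n h, G.actionKernel (StationaryPolicy.toPolicy G φ₁) (StationaryPolicy.toPolicy G φ₂) n h =
      d h.2

theorem ReturnBound.ne_top {istar : S} {R M : ℝ} (hret : G.ReturnBound θ β istar R M)
    (φ₁ : G.Stat₁) (φ₂ : G.Stat₂) (i : S) :
    ∫⁻ ω, G.powReturnTime istar R ω ∂(G.statLaw φ₁ φ₂ i) ≠ ∞ := by
  refine ne_top_of_le_ne_top ENNReal.ofReal_ne_top (le_trans ?_ hret.moment_le)
  exact le_iSup_of_le φ₁ (le_iSup_of_le φ₂
    (le_iSup (fun i => ∫⁻ ω, G.powReturnTime istar R ω ∂(G.statLaw φ₁ φ₂ i)) i))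

theorem IsActionFamily.isControlProblem {D : S → Set (Measure G.K)} (hD : IsActionFamily D)
    (H : G.Regular β) (hθ : 0 < θ) {istar : S} {R M : ℝ} (hret : G.ReturnBound θ β istar R M)
    (hσ : Continuous (Function.uncurry σ)) (hb : ∀ k s, |σ k s| ≤ c)
    (hc : c = max (G.costBound G.ρ₁ β) (G.costBound G.ρ₂ β)) :
    G.IsControlProblem D (stageGain σ θ) istar c (θ * β) R := by
  have hc0 : 0 ≤ c := by
    rw [hc]
    exact le_max_of_le_left (Real.iSup_nonneg fun _ => abs_nonneg _)
  have hexp : Real.exp (2 * θ * β * c) ≤ R := by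
    rw [hc]
    exact hret.exp_le
  have hLip : 0 ≤ θ * β := mul_nonneg hθ.le H.pos.le
  have hcont := H.continuous_stageGain hθ hσ hb
  refine
    { isProbabilityMeasure := hD.isProbabilityMeasure
      measurable := fun g => (hcont g).measurable
      exists_min := fun g u hu i => hD.exists_min _ (H.continuous_mul_sum_trans (hcont g)
        (fun k => ?_) hu) (fun k => ?_) i
      nonneg := hc0
      one_le := (Real.one_le_exp (by
        rw [mul_assoc 2]
        exact mul_nonneg (mul_nonneg zero_le_two hLip) hc0)).trans hexp
      le_bound := fun g hg k =>
        (H.stageGain_le hθ hb hg k).trans (ENNReal.ofReal_le_ofReal hexp)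
      le_one := H.stageGain_le_one hθ hb
      one_le_neg := H.one_le_stageGain_neg hθ hb
      le_exp_mul := fun g g' k => H.stageGain_le_exp_mul hθ g g' k
      lip_nonneg := hLip
      exists_stat := hD.exists_stat
      return_ne_top := hret.ne_top }
  · rw [H.stageGain_eq hθ hσ hb]
    exact ENNReal.ofReal_ne_top
  · rw [H.stageGain_eq hθ hσ hb]
    exact ENNReal.mul_ne_top ENNReal.ofReal_ne_top (ENNReal.sum_ne_top.2 fun j _ =>
      ENNReal.mul_ne_top (measure_ne_top _ _) (hu j))

/-- Since $D^g$ is the normalized logarithm of $\Gamma^g$, the exponential of the summed stage costs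
is the product of the factors. -/
theorem returnCost_eq {istar i : S} {ρ : G.K → ℝ → ℝ} {g : ℝ} (hθ : 0 < θ)
    (hpos : ∀ k, 0 < G.expFactor ρ θ g k) (φ₁ : G.Stat₁) (φ₂ : G.Stat₂) :
    G.returnCost ρ θ g istar i φ₁ φ₂ = ((1 / θ : ℝ) : EReal) * ENNReal.log
      (∫⁻ ω, G.returnProd istar (fun k => ENNReal.ofReal (G.expFactor ρ θ g k)) ω
        ∂G.statLaw φ₁ φ₂ i) := by
  unfold returnCost
  congr 2
  refine lintegral_congr fun ω => ?_
  rw [returnProd, ← ENNReal.ofReal_prod_of_nonneg fun k _ => (hpos _).le, Finset.mul_sum,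
    Real.exp_sum]
  congr 1
  refine Finset.prod_congr rfl fun k _ => ?_
  rw [stageCost, ← mul_assoc, mul_one_div_cancel hθ.ne', one_mul, Real.exp_log (hpos _)]

theorem one_div_mul_log_ofReal_exp (hθ : 0 < θ) (x : ℝ) :
    ((1 / θ : ℝ) : EReal) * ENNReal.log (ENNReal.ofReal (Real.exp (θ * x))) = (x : EReal) := by
  rw [ENNReal.log_ofReal_of_pos (Real.exp_pos _), Real.log_exp, ← EReal.coe_mul, ← mul_assoc,
    one_div_mul_cancel hθ.ne', one_mul]

/-- The optimality equation of one player, with its interpretation as optimal average cost and as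
optimal cost until the return to `istar`. -/
theorem IsActionFamily.exists_solution {D : S → Set (Measure G.K)} (hD : IsActionFamily D)
    (H : G.Regular β) (hθ : 0 < θ) {istar : S} {R M : ℝ} (hret : G.ReturnBound θ β istar R M)
    {ρ : G.K → ℝ → ℝ} (hρ : ContinuousOn (fun x : G.K × ℝ => ρ x.1 x.2) (univ ×ˢ Icc 0 β))
    (hρc : G.costBound ρ β ≤ max (G.costBound G.ρ₁ β) (G.costBound G.ρ₂ β)) :
    ∃ (g : ℝ) (h : S → ℝ), h istar = 0 ∧
      (∀ i, ENNReal.ofReal (Real.exp (θ * h i)) = ⨅ μ ∈ D i, ∫⁻ k, ENNReal.ofReal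
        (G.expFactor ρ θ g k * ∑ j, Real.exp (θ * h j) * G.p k j) ∂μ) ∧
      (∀ (π₁ : G.Policy₁) (π₂ : G.Policy₂), (∀ n h, G.actionKernel π₁ π₂ n h ∈ D h.2) →
        ∀ i, g ≤ G.avgCost ρ θ i π₁ π₂) ∧
      (∀ (φ₁ : G.Stat₁) (φ₂ : G.Stat₂), (∀ n h, G.actionKernel (StationaryPolicy.toPolicy G φ₁)
        (StationaryPolicy.toPolicy G φ₂) n h ∈ D h.2) →
        ∀ i, h i ≤ G.returnCost ρ θ g istar i φ₁ φ₂) ∧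
      ∃ d : S → Measure G.K, (∀ i, d i ∈ D i) ∧ ∀ (φ₁ : G.Stat₁) (φ₂ : G.Stat₂),
        (∀ n h, G.actionKernel (StationaryPolicy.toPolicy G φ₁)
          (StationaryPolicy.toPolicy G φ₂) n h = d h.2) → ∀ i,
        G.avgCost ρ θ i (StationaryPolicy.toPolicy G φ₁) (StationaryPolicy.toPolicy G φ₂) ≤ g ∧
        G.returnCost ρ θ g istar i φ₁ φ₂ ≤ h i := by
  set c := max (G.costBound G.ρ₁ β) (G.costBound G.ρ₂ β) with hc
  set σ := clampCost β ρ with hσdef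
  have hσ : Continuous (Function.uncurry σ) := continuous_clampCost H.pos.le hρ
  have hσk : ∀ k, Continuous (σ k) := fun k => hσ.comp (Continuous.prodMk_right k)
  have hb : ∀ k s, |σ k s| ≤ c := fun k s => (H.abs_clampCost_le hρ k s).trans hρc
  have P := hD.isControlProblem H hθ hret hσ hb hc
  obtain ⟨q, hq1, hq⟩ := H.exists_lintegral_exp_neg_le
  obtain ⟨g, hg, u, hu1, hu0, hut, hle, d, hd, heq⟩ := P.exists_optimality_equation
  have hgc : |g| ≤ c := abs_le.2 hg
  have hγ : ∀ k, stageGain σ θ g k = ENNReal.ofReal (G.expFactor ρ θ g k) := fun k => by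
    rw [H.stageGain_eq hθ hσ hb, H.expFactor_clampCost]
  have hpos : ∀ k, 0 < G.expFactor ρ θ g k := fun k => by
    rw [← ENNReal.ofReal_pos, ← hγ]
    exact pos_iff_ne_zero.2 (P.stage_ne_zero g k)
  have habs : absorb istar u = u := by
    ext j
    unfold absorb
    split_ifs with hj
    · rw [hj, hu1]
    · rfl
  -- The additive form of the solution, $h=\frac1\theta\ln u$; the normalization $u(i^*)=1$ becomes
  -- $h(i^*)=0$.
  set h : S → ℝ := fun j => Real.log (u j).toReal / θ with hh
  have hu : ∀ j, ENNReal.ofReal (Real.exp (θ * h j)) = u j := fun j => by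
    rw [hh]
    simp only
    rw [mul_div_cancel₀ _ hθ.ne', Real.exp_log (ENNReal.toReal_pos (hu0 j) (hut j)),
      ENNReal.ofReal_toReal (hut j)]
  have hop : ∀ μ, G.stageOp (stageGain σ θ g) u μ = ∫⁻ k, ENNReal.ofReal
      (G.expFactor ρ θ g k * ∑ j, Real.exp (θ * h j) * G.p k j) ∂μ := fun μ => by
    refine lintegral_congr fun k => ?_
    rw [ENNReal.ofReal_mul (hpos k).le, hγ, ENNReal.ofReal_sum_of_nonneg
      (f := fun j => Real.exp (θ * h j) * G.p k j) fun j _ =>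
        mul_nonneg (Real.exp_pos _).le measureReal_nonneg]
    congr 1
    refine Finset.sum_congr rfl fun j _ => ?_
    rw [ENNReal.ofReal_mul (Real.exp_pos _).le, hu, p, ofReal_measureReal, mul_comm]
  have hfun : (fun k => ENNReal.ofReal (G.expFactor ρ θ g k)) = stageGain σ θ g :=
    funext fun k => (hγ k).symm
  have h1θ : (0 : EReal) ≤ ((1 / θ : ℝ) : EReal) := by
    exact_mod_cast (by positivity : (0 : ℝ) ≤ 1 / θ)
  refine ⟨g, h, by simp [hh, hu1], fun i => ?_, fun π₁ π₂ hπ i => ?_, fun φ₁ φ₂ hφ i => ?_,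
    d, hd, fun φ₁ φ₂ hφ i => ⟨?_, ?_⟩⟩
  · simp_rw [← hop, hu]
    exact le_antisymm (le_iInf₂ (hle i)) ((iInf₂_le _ (hd i)).trans (heq i).le)
  · rw [← H.avgCost_clampCost]
    exact le_avgCost π₁ π₂ i hθ hσk hb hgc H.sojourn_le hq1 hq (measurable_stageWeight hσ θ g)
      (fun k => rfl) hu0 hut fun n h' => hle _ _ (hπ n h')
  · rw [returnCost_eq hθ hpos, hfun, ← one_div_mul_log_ofReal_exp hθ (h i), hu]
    refine mul_le_mul_of_nonneg_left (ENNReal.log_monotone ?_) h1θ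
    refine G.le_lintegral_returnProd P.one_le (P.return_ne_top φ₁ φ₂ i) (P.measurable g)
      (P.le_bound g hg) hut fun n h' => ?_
    rw [habs]
    exact hle _ _ (hφ n h')
  · rw [← H.avgCost_clampCost]
    refine avgCost_le _ _ i hθ hσk hb hgc H.sojourn_le hq1 hq (measurable_stageWeight hσ θ g)
      (fun k => rfl) hu0 hut fun n h' => ?_
    rw [hφ]
    exact (heq _).le
  · rw [returnCost_eq hθ hpos, hfun, ← one_div_mul_log_ofReal_exp hθ (h i), hu]
    refine mul_le_mul_of_nonneg_left (ENNReal.log_monotone ?_) h1θ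
    refine G.lintegral_returnProd_le (P.return_ne_top φ₁ φ₂ i) (P.measurable g) fun n h' => ?_
    rw [habs, hφ]
    exact (heq _).le

/-! ### The two players -/

/-- The stationary policy given by a choice of action laws. -/
def StationaryPolicy.ofProbOn {Act : Type*} [MeasurableSpace Act] {adm : S → Set Act}
    (ψ : ∀ i, ProbOn (adm i)) : StationaryPolicy adm where
  kernel := ⟨fun i => (ψ i).1, measurable_of_finite _⟩
  isMarkov := ⟨fun i => (ψ i).2.1⟩
  admissible i := (ψ i).2.2

theorem nonempty_of_prob {X : Type*} [MeasurableSpace X] {C : Set X} {ψ : Measure X}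
    (h : ψ C = 1) : C.Nonempty := by
  refine nonempty_iff_ne_empty.2 fun he => ?_
  rw [he, measure_empty] at h
  exact zero_ne_one h

theorem dirac_mem {X : Type*} [MeasurableSpace X] {C : Set X} (hC : MeasurableSet C) {x : X}
    (hx : x ∈ C) : IsProbabilityMeasure (Measure.dirac x) ∧ Measure.dirac x C = 1 :=
  ⟨inferInstance, by rw [Measure.dirac_apply' _ hC, indicator_of_mem hx, Pi.one_apply]⟩

theorem le_lintegral_of_forall_mem {X : Type*} [MeasurableSpace X] {C : Set X}
    (hC : MeasurableSet C) {ψ : Measure X} [IsProbabilityMeasure ψ] (hψ : ψ C = 1)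
    {F : X → ℝ≥0∞} {m : ℝ≥0∞} (h : ∀ x ∈ C, m ≤ F x) : m ≤ ∫⁻ x, F x ∂ψ := by
  have hae : ∀ᵐ x ∂ψ, x ∈ C := (prob_compl_eq_zero_iff hC).2 hψ
  calc m = ∫⁻ _, m ∂ψ := by simp
    _ ≤ _ := lintegral_mono_ae (hae.mono h)

/-- The integral is affine in the law of the free action, so a Dirac mass at a minimizing action is
optimal among all randomizations. The policy `φ₁` serves only to show that the action sets of player
1 are nonempty. -/
theorem Regular.isActionFamily₁ (H : G.Regular β) (φ₁ : G.Stat₁) (φ₂ : G.Stat₂) :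
    IsActionFamily fun i => range fun ψ : ProbOn (G.act₁ i) =>
      G.actionLaw i ψ.1 (φ₂.kernel i) where
  isProbabilityMeasure := by
    rintro i _ ⟨ψ, rfl⟩
    have := ψ.2.1
    exact isProbabilityMeasure_actionLaw i _ _ ψ.2.2 (φ₂.admissible i)
  exists_min f hf hft i := by
    have hm := measurable_extendZero hf.measurable
    obtain ⟨C, hC, hCle⟩ := H.exists_extendZero_le hf hft
    obtain ⟨a, ha, hmin⟩ := exists_forall_lintegral_le (H.isCompact_act₁ i)
      (nonempty_of_prob (φ₁.admissible i)) (G.measurableSet_act₂ i) (φ₂.admissible i)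
      (f := fun a b => extendZero f (i, a, b))
      (fun a => hm.comp (measurable_prodMk_left.comp measurable_prodMk_left)) hC
      (fun a b => hCle _) fun b hb => (continuousOn_extendZero hf).comp
        (f := fun a => (i, a, b)) (by fun_prop) fun a ha => ⟨ha, hb⟩
    refine ⟨_, ⟨⟨Measure.dirac a, dirac_mem (G.measurableSet_act₁ i) ha⟩, rfl⟩, ?_⟩
    rintro _ ⟨ψ, rfl⟩
    have := ψ.2.1
    have hmi : Measurable fun z : A × B => extendZero f (i, z.1, z.2) :=
      hm.comp measurable_prodMk_left
    simp only
    rw [lintegral_actionLaw _ _ _ hf.measurable, lintegral_actionLaw _ _ _ hf.measurable,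
      lintegral_dirac' _ hmi.lintegral_prod_right']
    exact le_lintegral_of_forall_mem (G.measurableSet_act₁ i) ψ.2.2 hmin
  exists_stat d hd := by
    choose ψ hψ using hd
    refine ⟨StationaryPolicy.ofProbOn ψ, φ₂, fun n h => ?_⟩
    rw [actionKernel_apply, ← hψ]
    rfl

/-- The same argument with the order of integration exchanged, so that the action of player 2 is the
outer variable. -/
theorem Regular.isActionFamily₂ (H : G.Regular β) (φ₁ : G.Stat₁) (φ₂ : G.Stat₂) :
    IsActionFamily fun i => range fun φ : ProbOn (G.act₂ i) =>
      G.actionLaw i (φ₁.kernel i) φ.1 where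
  isProbabilityMeasure := by
    rintro i _ ⟨φ, rfl⟩
    have := φ.2.1
    exact isProbabilityMeasure_actionLaw i _ _ (φ₁.admissible i) φ.2.2
  exists_min f hf hft i := by
    have hm := measurable_extendZero hf.measurable
    obtain ⟨C, hC, hCle⟩ := H.exists_extendZero_le hf hft
    obtain ⟨b, hb, hmin⟩ := exists_forall_lintegral_le (H.isCompact_act₂ i)
      (nonempty_of_prob (φ₂.admissible i)) (G.measurableSet_act₁ i) (φ₁.admissible i)
      (f := fun b a => extendZero f (i, a, b))
      (fun b => hm.comp (measurable_prodMk_left.comp measurable_prodMk_right)) hC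
      (fun b a => hCle _) fun a ha => (continuousOn_extendZero hf).comp
        (f := fun b => (i, a, b)) (by fun_prop) fun b hb => ⟨ha, hb⟩
    refine ⟨_, ⟨⟨Measure.dirac b, dirac_mem (G.measurableSet_act₂ i) hb⟩, rfl⟩, ?_⟩
    rintro _ ⟨φ, rfl⟩
    have := φ.2.1
    have hmi : Measurable fun z : B × A => extendZero f (i, z.2, z.1) :=
      hm.comp (measurable_prodMk_left.comp measurable_swap)
    simp only
    rw [lintegral_actionLaw_symm _ _ _ hf.measurable, lintegral_actionLaw_symm _ _ _ hf.measurable,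
      lintegral_dirac' _ hmi.lintegral_prod_right']
    exact le_lintegral_of_forall_mem (G.measurableSet_act₂ i) φ.2.2 hmin
  exists_stat d hd := by
    choose φ hφ using hd
    refine ⟨φ₁, StationaryPolicy.ofProbOn φ, fun n h => ?_⟩
    rw [actionKernel_apply, ← hφ]
    rfl

theorem StationaryPolicy.toPolicy_kernel {Act : Type*} [MeasurableSpace Act] {adm : S → Set Act}
    (φ : StationaryPolicy adm) (n : ℕ) (h : G.Hist n) :
    (StationaryPolicy.toPolicy G φ).kernel n h = φ.kernel h.2 :=
  rfl

/-- The best response of player 1 to the stationary policy `φ₂`. -/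
theorem Regular.exists_best_response₁ (H : G.Regular β) (hθ : 0 < θ) {istar : S} {R M : ℝ}
    (hret : G.ReturnBound θ β istar R M) (φ₁ : G.Stat₁) (φ₂ : G.Stat₂) :
    ∃ (g : ℝ) (h : S → ℝ), h istar = 0 ∧
      (∀ i, ENNReal.ofReal (Real.exp (θ * h i)) =
        ⨅ ψ : ProbOn (G.act₁ i), G.bellman G.ρ₁ θ g h i ψ.1 (φ₂.kernel i)) ∧
      (∀ i, (g : EReal) =
        ⨅ π₁ : G.Policy₁, G.avgCost G.ρ₁ θ i π₁ (StationaryPolicy.toPolicy G φ₂)) ∧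
      ∀ i, (h i : EReal) = ⨅ φ₁' : G.Stat₁, G.returnCost G.ρ₁ θ g istar i φ₁' φ₂ := by
  obtain ⟨g, h, hs, hopt, havg, hcost, d, hd, hatt⟩ :=
    (H.isActionFamily₁ φ₁ φ₂).exists_solution H hθ hret H.continuousOn_ρ₁ (le_max_left _ _)
  choose ψ hψ using hd
  have hatt' := hatt (StationaryPolicy.ofProbOn ψ) φ₂ fun n h' => by
    rw [actionKernel_apply, ← hψ]
    rfl
  -- Against a stationary opponent even a history-dependent policy produces, given the history, a
  -- stage law from the family of the current state; this brings all of $\Pi_1$ under the lower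
  -- bound.
  have hmem : ∀ (π : G.Policy₁) (n : ℕ) (h' : G.Hist n),
      G.actionKernel π (StationaryPolicy.toPolicy G φ₂) n h' ∈
        range fun ψ : ProbOn (G.act₁ h'.2) => G.actionLaw h'.2 ψ.1 (φ₂.kernel h'.2) :=
    fun π n h' => by
      rw [actionKernel_apply, StationaryPolicy.toPolicy_kernel]
      exact ⟨⟨π.kernel n h', π.isMarkov n |>.isProbabilityMeasure h', π.admissible n h'⟩, rfl⟩
  refine ⟨g, h, hs, fun i => ?_, fun i => ?_, fun i => ?_⟩
  · rw [hopt i, iInf_range]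
    rfl
  · exact le_antisymm (le_iInf fun π => havg π _ (hmem π) i) ((iInf_le _ _).trans (hatt' i).1)
  · exact le_antisymm (le_iInf fun φ' => hcost φ' φ₂ (hmem _) i) ((iInf_le _ _).trans (hatt' i).2)

/-- The best response of player 2 to the stationary policy `φ₁`. -/
theorem Regular.exists_best_response₂ (H : G.Regular β) (hθ : 0 < θ) {istar : S} {R M : ℝ}
    (hret : G.ReturnBound θ β istar R M) (φ₁ : G.Stat₁) (φ₂ : G.Stat₂) :
    ∃ (g : ℝ) (h : S → ℝ), h istar = 0 ∧
      (∀ i, ENNReal.ofReal (Real.exp (θ * h i)) =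
        ⨅ φ : ProbOn (G.act₂ i), G.bellman G.ρ₂ θ g h i (φ₁.kernel i) φ.1) ∧
      (∀ i, (g : EReal) =
        ⨅ π₂ : G.Policy₂, G.avgCost G.ρ₂ θ i (StationaryPolicy.toPolicy G φ₁) π₂) ∧
      ∀ i, (h i : EReal) = ⨅ φ₂' : G.Stat₂, G.returnCost G.ρ₂ θ g istar i φ₁ φ₂' := by
  obtain ⟨g, h, hs, hopt, havg, hcost, d, hd, hatt⟩ :=
    (H.isActionFamily₂ φ₁ φ₂).exists_solution H hθ hret H.continuousOn_ρ₂ (le_max_right _ _)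
  choose φ hφ using hd
  have hatt' := hatt φ₁ (StationaryPolicy.ofProbOn φ) fun n h' => by
    rw [actionKernel_apply, ← hφ]
    rfl
  have hmem : ∀ (π : G.Policy₂) (n : ℕ) (h' : G.Hist n),
      G.actionKernel (StationaryPolicy.toPolicy G φ₁) π n h' ∈
        range fun φ : ProbOn (G.act₂ h'.2) => G.actionLaw h'.2 (φ₁.kernel h'.2) φ.1 :=
    fun π n h' => by
      rw [actionKernel_apply, StationaryPolicy.toPolicy_kernel]
      exact ⟨⟨π.kernel n h', π.isMarkov n |>.isProbabilityMeasure h', π.admissible n h'⟩, rfl⟩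
  refine ⟨g, h, hs, fun i => ?_, fun i => ?_, fun i => ?_⟩
  · rw [hopt i, iInf_range]
    rfl
  · exact le_antisymm (le_iInf fun π => havg _ π (hmem π) i) ((iInf_le _ _).trans (hatt' i).1)
  · exact le_antisymm (le_iInf fun φ' => hcost φ₁ φ' (hmem _) i) ((iInf_le _ _).trans (hatt' i).2)

end SemiMarkovGame

end

theorem mainTheorem5 {S A B : Type*}
    [Fintype S] [TopologicalSpace S] [DiscreteTopology S]
    [MeasurableSpace S] [DiscreteMeasurableSpace S]
    [TopologicalSpace A] [TopologicalSpace.MetrizableSpace A] [SecondCountableTopology A]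
    [MeasurableSpace A] [BorelSpace A] [StandardBorelSpace A]
    [TopologicalSpace B] [TopologicalSpace.MetrizableSpace B] [SecondCountableTopology B]
    [MeasurableSpace B] [BorelSpace B] [StandardBorelSpace B]
    (G : SemiMarkovGame S A B) (θ β : ℝ) (hθ : 0 < θ) (istar : S)
    (hreg : G.Regular β) (hirr : G.Irreducible)
    (hret : ∃ R M : ℝ, G.ReturnBound θ β istar R M)
    (φ₁ : G.Stat₁) (φ₂ : G.Stat₂) :
    ∃ (g₁ g₂ : ℝ) (h₁ h₂ : S → ℝ),
      h₁ istar = 0 ∧ h₂ istar = 0 ∧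
      -- the best-response optimality equations of player 1 against `φ₂`, of player 2 against `φ₁`
      (∀ i, ENNReal.ofReal (Real.exp (θ * h₂ i)) =
        ⨅ ψ : SemiMarkovGame.ProbOn (G.act₁ i), G.bellman G.ρ₁ θ g₂ h₂ i ψ.1 (φ₂.kernel i)) ∧
      (∀ i, ENNReal.ofReal (Real.exp (θ * h₁ i)) =
        ⨅ φ : SemiMarkovGame.ProbOn (G.act₂ i), G.bellman G.ρ₂ θ g₁ h₁ i (φ₁.kernel i) φ.1) ∧
      -- the constants are the optimal risk-sensitive average costs
      (∀ i, (g₂ : EReal) =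
        ⨅ π₁ : G.Policy₁, G.avgCost G.ρ₁ θ i π₁ (SemiMarkovGame.StationaryPolicy.toPolicy G φ₂)) ∧
      (∀ i, (g₁ : EReal) =
        ⨅ π₂ : G.Policy₂, G.avgCost G.ρ₂ θ i (SemiMarkovGame.StationaryPolicy.toPolicy G φ₁) π₂) ∧
      -- the representation of the functions through the first return to `istar`
      (∀ i, i ≠ istar → (h₂ i : EReal) =
        ⨅ φ₁' : G.Stat₁, G.returnCost G.ρ₁ θ g₂ istar i φ₁' φ₂) ∧
      (∀ i, i ≠ istar → (h₁ i : EReal) =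
        ⨅ φ₂' : G.Stat₂, G.returnCost G.ρ₂ θ g₁ istar i φ₁ φ₂') := by
  obtain ⟨R, M, hRM⟩ := hret
  obtain ⟨g₂, h₂, hs₂, hopt₂, havg₂, hcost₂⟩ :=
    hreg.exists_best_response₁ hθ hRM φ₁ φ₂
  obtain ⟨g₁, h₁, hs₁, hopt₁, havg₁, hcost₁⟩ :=
    hreg.exists_best_response₂ hθ hRM φ₁ φ₂
  exact ⟨g₁, g₂, h₁, h₂, hs₁, hs₂, hopt₂, hopt₁, havg₂, havg₁, fun i _ => hcost₂ i,
    fun i _ => hcost₁ i⟩
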